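/- **Theorem** (Joswig & Ziegler, by a new construction). Let $2\le d\le n$ be integers. There is a cubical $d$-polytope (a $d$-polytope all of whose nonempty proper faces are combinatorial cubes) whose $(\lfloor d/2\rfloor-1)$-skeleton is isomorphic to that of the $n$-cube. Explicitly, it is obtained as follows. *Neighborly configurations.* A list $v_1,\dots,v_{n-1}\in\mathbb R^{d-2}$ is called a neighborly $(d-2)$-polytope on $n-1$ ordered vertices in general position if any $d-1$ of the points are affinely independent and, for every index set $I$ with $|I|\le\lfloor (d-2)/2\rfloor$, there is a face of $\operatorname{conv}\{v_1,\dots,v_{n-1}\}$ that contains $v_i$ exactly for $i\in I$. (For $d\ge4$ the $v_i$ are then distinct and are the vertices of a polytope. For $d=2$ one has the point of $\mathbb R^0$ listed $n-1$ times, and for $d=3$ any $n-1$ distinct points of $\mathbb R^1$.) A Gale transform of $(v_i)$ is a matrix $G\in\mathbb R^{(n-1)\times(n-d)}$ whose columns form a basis of the orthogonal complement of the column span of the matrix with rows $(v_i,1)$. *Deformed cubes.* For $\bar G\in\mathbb R^{(d-1)\times(n-d)}$ with rows $g_1,\dots,g_{d-1}$, for $\varepsilon>0$ and a right-hand side $b=(b_i^{\pm})_{1\le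 i\le n}$, let $C_n(\bar G)\subset\mathbb R^n$ be the set of solutions of $$\pm\varepsilon x_1\le b_1^\pm,\qquad x_{i-1}\pm\varepsilon x_i\le b_i^\pm\ \ (2\le i\le n-d+1),\qquad g_j\cdot(x_1,\dots,x_{n-d})\pm\varepsilon x_{n-d+1+j}\le b_{n-d+1+j}^\pm\ \ (1\le j\le d-1).$$ The right-hand side $b$ is called suitable if the sets of inequalities that are simultaneously tight at some point of $C_n(\bar G)$ are exactly those that contain, for each $i$, at most one of the two inequalities with label $\pm i$ (as for the $n$-cube itself). *Claim.* Neighborly $(d-2)$-polytopes on $n-1$ ordered vertices in general position exist. Each of them has a Gale transform of the form $\binom{I_{n-d}}{\bar G}$. For each of them and each such $\bar G$ there is $\varepsilon_0>0$ such that for all $0<\varepsilon<\varepsilon_0$ suitable right-hand sides $b$ exist, and for every suitable $b$ the set $C_n(\bar G)$ is an $n$-polytope combinatorially isomorphic to the $n$-cube, and its projection to the last $d$ coordinates is a cubical $d$-polytope whose $(\lfloor d/2\rfloor-1)$-skeleton is isomorphic to that of the $n$-cube. -/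

import Mathlib

/-- The faces of a polytope `P`: the exposed subsets of `P`, that is, the sets on which some linear
functional attains its maximum over `P`, together with the empty face (`P` itself is the face of the
zero functional). They are ordered by inclusion. -/
def polytopeFaces {m : ℕ} (P : Set (Fin m → ℝ)) : Set (Set (Fin m → ℝ)) :=
  {F | IsExposed ℝ P F}

/-- The dimension of the affine span (only meaningful for nonempty sets; it is `0` for `∅`). -/
noncomputable def affDim {m : ℕ} (F : Set (Fin m → ℝ)) : ℕ :=
  Module.finrank ℝ (vectorSpan ℝ F)

/-- `P` is a `k`-polytope: a nonempty convex hull of finitely many points, of dimension `k`. -/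
def IsPolytopeOfDim {m : ℕ} (k : ℕ) (P : Set (Fin m → ℝ)) : Prop :=
  (∃ s : Finset (Fin m → ℝ), P = convexHull ℝ (s : Set (Fin m → ℝ))) ∧ P.Nonempty ∧ affDim P = k

/-- Two polytopes have the same combinatorial type: their face lattices are isomorphic. -/
def CombEquiv {m m' : ℕ} (P : Set (Fin m → ℝ)) (Q : Set (Fin m' → ℝ)) : Prop :=
  Nonempty (polytopeFaces P ≃o polytopeFaces Q)

/-- The faces of the `k`-skeleton of `P`: all faces of dimension at most `k`, including the
empty face. -/
def skeletonFaces {m : ℕ} (k : ℕ) (P : Set (Fin m → ℝ)) : Set (Set (Fin m → ℝ)) :=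
  {F | F ∈ polytopeFaces P ∧ affDim F ≤ k}

/-- The `k`-skeletons of `P` and `Q` are isomorphic (as face posets). -/
def SkeletonEquiv {m m' : ℕ} (k : ℕ) (P : Set (Fin m → ℝ)) (Q : Set (Fin m' → ℝ)) : Prop :=
  Nonempty (skeletonFaces k P ≃o skeletonFaces k Q)

/-- The standard `k`-cube `[0,1]^k`. -/
def stdCube (k : ℕ) : Set (Fin k → ℝ) := Set.Icc 0 1

/-- Every nonempty proper face of `P` is a combinatorial cube. -/
def IsCubical {m : ℕ} (P : Set (Fin m → ℝ)) : Prop :=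
  ∀ F ∈ polytopeFaces P, F.Nonempty → F ≠ P → ∃ k : ℕ, CombEquiv F (stdCube k)

/-- `P` is a cubical `d`-polytope whose `(⌊d/2⌋ - 1)`-skeleton is isomorphic to that of the
`n`-cube (used only for `2 ≤ d`, so that the subtraction is a true one). -/
def IsNeighborlyCubical {m : ℕ} (n d : ℕ) (P : Set (Fin m → ℝ)) : Prop :=
  IsPolytopeOfDim d P ∧ IsCubical P ∧ SkeletonEquiv (d / 2 - 1) P (stdCube n)

/-- For some face `F` of the convex hull of the configuration `v`, the points of `v` that lie in `F`
are exactly those indexed by `I`. If the `v i` are the vertices of a polytope, this says that `I`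
indexes the vertex set of a face. -/
def NamesFace {m e : ℕ} (v : Fin m → Fin e → ℝ) (I : Finset (Fin m)) : Prop :=
  ∃ F ∈ polytopeFaces (convexHull ℝ (Set.range v)), ∀ i, v i ∈ F ↔ i ∈ I

/-- `v` lists the `m` vertices of a neighborly `e`-polytope with vertices in general position:
any `e + 1` of the points are affinely independent, and any at most `⌊e/2⌋` of them form a face.
For `2 ≤ e` the second condition forces the points to be distinct vertices of their convex hull. For
`e = 0, 1` it is void, and `v` is any configuration of `m` points of `ℝ⁰` (listed with
multiplicity), or of `m` distinct points of `ℝ¹`. -/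
structure IsNeighborlyGeneral {m e : ℕ} (v : Fin m → Fin e → ℝ) : Prop where
  general_position : ∀ I : Finset (Fin m), I.card = e + 1 →
    AffineIndependent ℝ (fun i : I => v i)
  neighborly : ∀ I : Finset (Fin m), I.card ≤ e / 2 → NamesFace v I

/-- The homogenization `(V, 1)`, where the rows of `V` are the points `v i`. -/
def homogenization {m e : ℕ} (v : Fin m → Fin e → ℝ) : Matrix (Fin m) (Fin e ⊕ Unit) ℝ :=
  Matrix.fromCols (Matrix.of v) (Matrix.of fun _ _ => 1)

/-- `G` is a Gale transform of `v`: its columns form a basis of the orthogonal complement of the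
column span of `(V, 1)`. -/
structure IsGaleTransform {m e k : ℕ} (v : Fin m → Fin e → ℝ) (G : Matrix (Fin m) (Fin k) ℝ) :
    Prop where
  linearIndependent : LinearIndependent ℝ G.col
  span_col : ∀ w : Fin m → ℝ,
    w ∈ Submodule.span ℝ (Set.range G.col) ↔ Matrix.vecMul w (homogenization v) = 0

/-- The matrix whose first `n - d` rows form the identity and whose last `d - 1` rows are those
of `g`. -/
def stackIdentity {n d : ℕ} (g : Matrix (Fin (d - 1)) (Fin (n - d)) ℝ) :
    Matrix (Fin (n - 1)) (Fin (n - d)) ℝ := fun i j =>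
  if h : n - d ≤ i.val then g ⟨i.val - (n - d), by omega⟩ j
  else if i.val = j.val then 1 else 0

/-- The left-hand side of the deformed cube template. The label `(i, true)` stands for the row
`+i`, the label `(i, false)` for the row `-i` (with `i` counted from `0`). Row `± i` has the entry
`± ε` on the diagonal; the rows with `1 ≤ i ≤ n - d` have a `1` directly to the left of it; the last
`d - 1` rows have the rows of `g` in the first `n - d` columns; all other entries vanish. -/
noncomputable def deformedLhs {n d : ℕ} (ε : ℝ) (g : Matrix (Fin (d - 1)) (Fin (n - d)) ℝ) :
    Matrix (Fin n × Bool) (Fin n) ℝ := fun r j =>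
  if j = r.1 then (if r.2 then ε else -ε)
  else if h : n - d < r.1.val ∧ j.val < n - d then
    g ⟨r.1.val - (n - d) - 1, by omega⟩ ⟨j.val, h.2⟩
  else if r.1.val ≤ n - d ∧ j.val + 1 = r.1.val then 1 else 0

/-- The deformed cube `C_n(g)` with parameter `ε` and right-hand side `b`. -/
def deformedCube {n d : ℕ} (ε : ℝ) (g : Matrix (Fin (d - 1)) (Fin (n - d)) ℝ)
    (b : Fin n × Bool → ℝ) : Set (Fin n → ℝ) :=
  {x | ∀ r, (deformedLhs ε g).mulVec x r ≤ b r}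

/-- The right-hand side `b` is suitable: the deformed cube has the same equality sets as the
undeformed `n`-cube, that is, the sets of inequalities which are tight at some point of it are
exactly the sets of labels that contain at most one of `+i`, `-i` for every `i`. -/
def IsSuitableRhs {n d : ℕ} (ε : ℝ) (g : Matrix (Fin (d - 1)) (Fin (n - d)) ℝ)
    (b : Fin n × Bool → ℝ) : Prop :=
  ∀ S : Set (Fin n × Bool),
    (∃ x ∈ deformedCube ε g b, {r | (deformedLhs ε g).mulVec x r = b r} = S) ↔
      ∀ i, ¬ ((i, true) ∈ S ∧ (i, false) ∈ S)

/-- The projection `ℝⁿ → ℝᵈ` to the last `d` coordinates. -/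
def lastCoords {n d : ℕ} (h : d ≤ n) (x : Fin n → ℝ) : Fin d → ℝ :=
  fun j => x ⟨n - d + j.val, by omega⟩

/-!
The combinatorics of the deformed cube `C` and of its projection is read off from equality sets.
For a polyhedron given by finitely many inequalities, a nonempty exposed subset is the set of points
at which a certain realizable equality set is tight (`exists_eq_tightFace_of_isExposed`), so the face
lattice depends only on the realizable equality sets (`nonempty_polytopeFaces_orderIso`). If these
are the ones of the cube, then all faces are combinatorial cubes, and their dimensions can be
counted along chains of faces (`affDim_tightFace_add_ncard`). Suitable right-hand sides exist since
the system is triangular (`exists_isSuitableRhs`).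

Restricted to the kernel of the projection, which is spanned by the first `n - d` coordinates, the
rows `± i` of the deformed cube are `ε`-perturbations of the rows of the Gale transform, except for
the first pair, which is `± ε` times a unit vector. Gale duality turns the two properties of the
configuration into properties of these rows:

* General position means that any `n - d` rows of the Gale transform span. This survives the
  perturbation, and the first pair of rows does no harm (`RowsSpan`, `rowsSpan_of_lowerRow_large`).
  A face of `C` in at least `n - d` facets is then mapped injectively, while a face in fewer facets
  is not the preimage of a proper face of the projection (`exists_eq_image_tightFace`). Hence the
  projection is cubical.
* Neighborliness means that the rows of the Gale transform outside any set of `⌊d/2⌋ - 1` indices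
  span positively. This survives the perturbation as well (`RowsSpanPositively`). By Stiemke's lemma
  a positive combination of the normals of a face of `C` of dimension at most `⌊d/2⌋ - 1` vanishes on
  the kernel of the projection, so that the face is the preimage of a face of the projection
  (`exists_functional_of_rowsSpanPositively`).

Both conditions are compared with their perturbations through compactness of the unit sphere
(`exists_margin`). Points on the moment curve give a neighborly configuration.
-/

/-! ### Systems of affine inequalities and the faces they define -/

/-- The inequalities of the system `f` (read as `0 ≤ f r x`) that are tight at `x`. -/
def zeroSet {R : Type*} {m : ℕ} (f : R → (Fin m → ℝ) →ᵃ[ℝ] ℝ) (x : Fin m → ℝ) : Set R :=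
  {r | f r x = 0}

/-- The points that satisfy all inequalities `0 ≤ f r x`, those with label in `S` with equality.
The polyhedron defined by the system is the case `S = ∅`. -/
def tightFace {R : Type*} {m : ℕ} (f : R → (Fin m → ℝ) →ᵃ[ℝ] ℝ) (S : Set R) :
    Set (Fin m → ℝ) :=
  {x | (∀ r, 0 ≤ f r x) ∧ S ⊆ zeroSet f x}

/-- `S` is the equality set of some point of the polyhedron defined by the system `f`. -/
def IsEqualitySet {R : Type*} {m : ℕ} (f : R → (Fin m → ℝ) →ᵃ[ℝ] ℝ) (S : Set R) : Prop :=
  ∃ x, (∀ r, 0 ≤ f r x) ∧ zeroSet f x = S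

lemma tightFace_anti {R : Type*} {m : ℕ} (f : R → (Fin m → ℝ) →ᵃ[ℝ] ℝ) {S T : Set R}
    (h : S ⊆ T) : tightFace f T ⊆ tightFace f S :=
  fun _ hx => ⟨hx.1, h.trans hx.2⟩

lemma IsEqualitySet.nonempty {R : Type*} {m : ℕ} {f : R → (Fin m → ℝ) →ᵃ[ℝ] ℝ} {S : Set R}
    (h : IsEqualitySet f S) : (tightFace f S).Nonempty := by
  obtain ⟨x, hx, rfl⟩ := h
  exact ⟨x, hx, subset_rfl⟩

lemma IsEqualitySet.tightFace_subset_iff {R : Type*} {m : ℕ} {f : R → (Fin m → ℝ) →ᵃ[ℝ] ℝ}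
    {S T : Set R} (h : IsEqualitySet f S) : tightFace f S ⊆ tightFace f T ↔ T ⊆ S := by
  refine ⟨fun hST => ?_, tightFace_anti f⟩
  obtain ⟨x, hx, rfl⟩ := h
  exact (hST ⟨hx, subset_rfl⟩).2

lemma affine_lineMap_apply {m : ℕ} (g : (Fin m → ℝ) →ᵃ[ℝ] ℝ) (x z : Fin m → ℝ) (t : ℝ) :
    g (AffineMap.lineMap x z t) = (1 - t) * g x + t * g z := by
  rw [AffineMap.apply_lineMap, AffineMap.lineMap_apply_module]; simp

/-- From a point of a polyhedron one can move a little towards any point that satisfies the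
inequalities which are tight at the start. -/
lemma exists_lineMap_feasible {R : Type*} [Finite R] {m : ℕ} {f : R → (Fin m → ℝ) →ᵃ[ℝ] ℝ}
    {x z : Fin m → ℝ} (hx : ∀ r, 0 ≤ f r x) (hz : ∀ r ∈ zeroSet f x, 0 ≤ f r z) :
    ∃ t : ℝ, 0 < t ∧ ∀ r, 0 ≤ f r (AffineMap.lineMap x z t) := by
  have key : ∀ᶠ t : ℝ in nhdsWithin 0 (Set.Ioi 0),
      ∀ r, 0 ≤ f r (AffineMap.lineMap x z t) := by
    rw [Filter.eventually_all]
    intro r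
    by_cases hr : f r x = 0
    · filter_upwards [self_mem_nhdsWithin] with t ht
      rw [affine_lineMap_apply, hr]
      have := mul_nonneg (le_of_lt ht) (hz r hr)
      linarith
    · have hpos : 0 < f r x := lt_of_le_of_ne (hx r) (Ne.symm hr)
      have hc : Continuous fun t : ℝ => (1 - t) * f r x + t * f r z := by fun_prop
      have h0 : ∀ᶠ t in nhds (0 : ℝ), 0 < (1 - t) * f r x + t * f r z :=
        hc.continuousAt.eventually_const_lt (by simpa using hpos)
      filter_upwards [h0.filter_mono nhdsWithin_le_nhds] with t ht
      rw [affine_lineMap_apply]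
      exact ht.le
  obtain ⟨t, ht, ht0⟩ := (key.and self_mem_nhdsWithin).exists
  exact ⟨t, ht0, ht⟩

lemma zeroSet_midpoint {R : Type*} {m : ℕ} {f : R → (Fin m → ℝ) →ᵃ[ℝ] ℝ}
    {x y : Fin m → ℝ} (hx : ∀ r, 0 ≤ f r x) (hy : ∀ r, 0 ≤ f r y) :
    (∀ r, 0 ≤ f r (AffineMap.lineMap x y (1 / 2 : ℝ))) ∧
      zeroSet f (AffineMap.lineMap x y (1 / 2 : ℝ)) = zeroSet f x ∩ zeroSet f y := by
  refine ⟨fun r => ?_, Set.ext fun r => ?_⟩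
  · rw [affine_lineMap_apply]; linarith [hx r, hy r]
  · simp only [zeroSet, Set.mem_ofPred_eq, Set.mem_inter_iff, affine_lineMap_apply]
    have := hx r
    have := hy r
    constructor
    · intro h; constructor <;> linarith
    · rintro ⟨h1, h2⟩; rw [h1, h2]; simp

lemma linear_lineMap_apply {m : ℕ} (l : StrongDual ℝ (Fin m → ℝ)) (x z : Fin m → ℝ) (t : ℝ) :
    l (AffineMap.lineMap x z t) = l x + t * (l z - l x) := by
  rw [AffineMap.lineMap_apply_module]
  simp only [map_add, map_smul, smul_eq_mul]; ring

/-- If `l` attains its maximum over a face at a point, it is maximal on the whole smallest face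
through that point. -/
lemma maximal_of_zeroSet_subset {R : Type*} [Finite R] {m : ℕ}
    {f : R → (Fin m → ℝ) →ᵃ[ℝ] ℝ} {S : Set R} {l : StrongDual ℝ (Fin m → ℝ)}
    {x y : Fin m → ℝ} (hx : x ∈ tightFace f S) (hmax : ∀ z ∈ tightFace f S, l z ≤ l x)
    (hy : y ∈ tightFace f (zeroSet f x)) : l x ≤ l y := by
  -- `z` is the reflection of `y` in `x`, at which the inequalities tight at `x` are tight too
  set z : Fin m → ℝ := AffineMap.lineMap x y (-1 : ℝ) with hzdef
  have hz0 : ∀ r ∈ zeroSet f x, f r z = 0 := fun r hr => by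
    rw [hzdef, affine_lineMap_apply, show f r x = 0 from hr, show f r y = 0 from hy.2 hr]; simp
  obtain ⟨t, ht, hf⟩ := exists_lineMap_feasible hx.1 (z := z) fun r hr => (hz0 r hr).ge
  have := hmax (AffineMap.lineMap x z t) ⟨hf, fun s hs => by
    have hs' := hx.2 hs
    change f s _ = 0
    rw [affine_lineMap_apply, hz0 s hs', show f s x = 0 from hs']; simp⟩
  rw [linear_lineMap_apply, hzdef, linear_lineMap_apply] at this
  have h2 : 0 ≤ t * (l y - l x) := by nlinarith
  have := nonneg_of_mul_nonneg_right h2 ht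
  linarith

/-- The nonempty faces of a face are given by the larger equality sets. -/
theorem exists_eq_tightFace_of_isExposed {R : Type*} [Finite R] {m : ℕ}
    {f : R → (Fin m → ℝ) →ᵃ[ℝ] ℝ} {S : Set R} {F : Set (Fin m → ℝ)}
    (hF : IsExposed ℝ (tightFace f S) F) (hne : F.Nonempty) :
    ∃ T, IsEqualitySet f T ∧ S ⊆ T ∧ F = tightFace f T := by
  obtain ⟨l, hl⟩ := hF hne
  -- a point of `F` with the smallest equality set lies in the relative interior of `F`
  obtain ⟨T, ⟨x, hxF, rfl⟩, hmin⟩ := (Set.toFinite (zeroSet f '' F)).exists_minimal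
    (hne.image _)
  have hxF' := hxF
  rw [hl] at hxF
  refine ⟨zeroSet f x, ⟨x, hxF.1.1, rfl⟩, hxF.1.2, Set.Subset.antisymm ?_ ?_⟩
  · intro y hyF
    have hyF' := hyF
    rw [hl] at hyF
    obtain ⟨hm, hz⟩ := zeroSet_midpoint hxF.1.1 hyF.1.1
    refine ⟨hyF.1.1, ?_⟩
    have hmem : AffineMap.lineMap x y (1 / 2 : ℝ) ∈ F := by
      rw [hl]
      refine ⟨⟨hm, hz ▸ Set.subset_inter hxF.1.2 hyF.1.2⟩, fun w hw => ?_⟩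
      rw [linear_lineMap_apply]
      have h1 := hxF.2 w hw
      have h2 := hyF.2 w hw
      linarith
    have := hmin ⟨_, hmem, rfl⟩ (by rw [hz]; exact Set.inter_subset_left)
    rw [hz] at this
    exact this.trans Set.inter_subset_right
  · intro y hy
    rw [hl]
    refine ⟨tightFace_anti f hxF.1.2 hy, fun w hw => ?_⟩
    exact (hxF.2 w hw).trans (maximal_of_zeroSet_subset hxF.1 hxF.2 hy)

/-- A positive combination of the normals of `T` is maximal over the polyhedron exactly on the
face where all inequalities in `T` are tight. -/
lemma tightFace_eq_argmax {R : Type*} {m : ℕ} {f : R → (Fin m → ℝ) →ᵃ[ℝ] ℝ} {S T : Set R}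
    [Fintype T] (hST : S ⊆ T) (hne : (tightFace f T).Nonempty) {c : T → ℝ} (hc : ∀ r, 0 < c r)
    {l : StrongDual ℝ (Fin m → ℝ)} (hl : ∀ x y, l x - l y = ∑ r : T, c r * (f r y - f r x)) :
    tightFace f T = {x ∈ tightFace f S | ∀ y ∈ tightFace f S, l y ≤ l x} := by
  obtain ⟨x₀, hx₀⟩ := hne
  ext x
  constructor
  · intro hx
    refine ⟨tightFace_anti f hST hx, fun y hy => ?_⟩
    have h : 0 ≤ l x - l y := by
      rw [hl]
      refine Finset.sum_nonneg fun r _ => ?_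
      rw [show f r x = 0 from hx.2 r.2, sub_zero]
      exact mul_nonneg (hc r).le (hy.1 r)
    linarith
  · rintro ⟨hx, hmax⟩
    refine ⟨hx.1, fun r hr => ?_⟩
    have h : l x₀ - l x = ∑ r : T, c r * f r x := by
      rw [hl]
      refine Finset.sum_congr rfl fun r _ => ?_
      rw [show f r x₀ = 0 from hx₀.2 r.2, sub_zero]
    have hle := hmax x₀ (tightFace_anti f hST hx₀)
    have hnn : ∀ r ∈ (Finset.univ : Finset T), 0 ≤ c r * f r x := fun r _ =>
      mul_nonneg (hc r).le (hx.1 r)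
    have hs := le_antisymm (by linarith) (Finset.sum_nonneg hnn)
    have := (Finset.sum_eq_zero_iff_of_nonneg hnn).1 hs ⟨r, hr⟩ (Finset.mem_univ _)
    exact (mul_eq_zero.1 this).resolve_left (hc _).ne'

theorem isExposed_tightFace {R : Type*} [Finite R] {m : ℕ}
    {f : R → (Fin m → ℝ) →ᵃ[ℝ] ℝ} {S T : Set R} (hST : S ⊆ T)
    (hne : (tightFace f T).Nonempty) : IsExposed ℝ (tightFace f S) (tightFace f T) := by
  intro _
  have := Fintype.ofFinite T
  let l : (Fin m → ℝ) →ₗ[ℝ] ℝ := - ∑ r : T, (f r).linear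
  refine ⟨LinearMap.toContinuousLinearMap l, tightFace_eq_argmax hST hne (c := fun _ => 1)
    (fun _ => one_pos) fun x y => ?_⟩
  rw [← map_sub]
  simp only [LinearMap.coe_toContinuousLinearMap', l, LinearMap.neg_apply, LinearMap.sum_apply,
    ← Finset.sum_neg_distrib, one_mul]
  refine Finset.sum_congr rfl fun r _ => ?_
  rw [← map_neg, neg_sub]
  exact (f r).linearMap_vsub y x

/-- A family of sets that consists of `∅` and of nonempty sets indexed by a poset in an
order-reflecting way is that poset with a bottom element added. -/
lemma nonempty_withBot_orderIso {α X : Type*} [PartialOrder α] (𝓕 : Set (Set X)) (φ : α → Set X)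
    (h0 : ∅ ∈ 𝓕) (hφ : ∀ a, φ a ∈ 𝓕) (hne : ∀ a, (φ a).Nonempty)
    (hsurj : ∀ F ∈ 𝓕, F.Nonempty → ∃ a, F = φ a) (hle : ∀ a b, φ a ⊆ φ b ↔ a ≤ b) :
    Nonempty (WithBot α ≃o 𝓕) := by
  let g : WithBot α → 𝓕 := fun a => match a with
    | ⊥ => ⟨∅, h0⟩
    | (a : α) => ⟨φ a, hφ a⟩
  have hg : ∀ a b, g a ≤ g b ↔ a ≤ b := by
    intro a b
    induction a with
    | bot => exact iff_of_true (Set.empty_subset (g b).1) bot_le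
    | coe a =>
      induction b with
      | bot =>
        simp only [WithBot.not_coe_le_bot, iff_false]
        exact fun h => (hne a).ne_empty (Set.subset_empty_iff.1 h)
      | coe b => rw [WithBot.coe_le_coe, ← hle]; exact Iff.rfl
  refine ⟨RelIso.ofSurjective (OrderEmbedding.ofMapLEIff g hg) ?_⟩
  rintro ⟨F, hF⟩
  rcases F.eq_empty_or_nonempty with rfl | h
  · exact ⟨⊥, rfl⟩
  · obtain ⟨a, rfl⟩ := hsurj F hF h
    exact ⟨(a : WithBot α), rfl⟩

/-- The equality sets containing `S`, ordered by reverse inclusion. -/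
abbrev EqualitySetsAbove {R : Type*} {m : ℕ} (f : R → (Fin m → ℝ) →ᵃ[ℝ] ℝ) (S : Set R) :=
  {T : Set R // IsEqualitySet f T ∧ S ⊆ T}ᵒᵈ

theorem nonempty_polytopeFaces_orderIso {R : Type*} [Finite R] {m : ℕ}
    (f : R → (Fin m → ℝ) →ᵃ[ℝ] ℝ) (S : Set R) :
    Nonempty (WithBot (EqualitySetsAbove f S) ≃o polytopeFaces (tightFace f S)) := by
  refine nonempty_withBot_orderIso _ (fun T => tightFace f (OrderDual.ofDual T).1) ?_ ?_ ?_ ?_ ?_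
  · exact fun h => absurd h Set.not_nonempty_empty
  · exact fun T => isExposed_tightFace T.2.2 T.2.1.nonempty
  · exact fun T => T.2.1.nonempty
  · intro F hF hne
    obtain ⟨T, hT, hST, rfl⟩ := exists_eq_tightFace_of_isExposed hF hne
    exact ⟨OrderDual.toDual ⟨T, hT, hST⟩, rfl⟩
  · exact fun T T' => T.2.1.tightFace_subset_iff

lemma vectorSpan_tightFace_le {R : Type*} {m : ℕ} (f : R → (Fin m → ℝ) →ᵃ[ℝ] ℝ) {S : Set R}
    {r : R} (hr : r ∈ S) : vectorSpan ℝ (tightFace f S) ≤ LinearMap.ker (f r).linear := by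
  rw [vectorSpan_def, Submodule.span_le]
  rintro _ ⟨x, hx, y, hy, rfl⟩
  change (f r).linear (x -ᵥ y) = 0
  rw [AffineMap.linearMap_vsub, show f r x = 0 from hx.2 hr, show f r y = 0 from hy.2 hr]
  simp

lemma affDim_tightFace_lt {R : Type*} {m : ℕ} {f : R → (Fin m → ℝ) →ᵃ[ℝ] ℝ} {S T : Set R}
    (hS : IsEqualitySet f S) (hT : IsEqualitySet f T) (hST : S ⊂ T) :
    affDim (tightFace f T) < affDim (tightFace f S) := by
  refine Submodule.finrank_lt_finrank_of_lt (lt_of_le_of_ne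
    (vectorSpan_mono ℝ (tightFace_anti f hST.1)) fun h => ?_)
  obtain ⟨r, hrT, hrS⟩ := Set.exists_of_ssubset hST
  obtain ⟨x, hx, rfl⟩ := hS
  obtain ⟨y, hy⟩ := hT.nonempty
  have hmem : x -ᵥ y ∈ vectorSpan ℝ (tightFace f (zeroSet f x)) :=
    vsub_mem_vectorSpan ℝ ⟨hx, subset_rfl⟩ (tightFace_anti f hST.1 hy)
  rw [← h] at hmem
  have := vectorSpan_tightFace_le f hrT hmem
  rw [LinearMap.mem_ker, AffineMap.linearMap_vsub, show f r y = 0 from hy.2 hrT] at this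
  rw [vsub_eq_sub, sub_zero] at this
  exact hrS this

/-- A bounded polyhedron is the convex hull of finitely many points: its extreme points are
determined by their equality sets. -/
lemma exists_finset_convexHull_eq {R : Type*} [Finite R] {m : ℕ}
    (f : R → (Fin m → ℝ) →ᵃ[ℝ] ℝ) (hcomp : IsCompact (tightFace f ∅)) :
    ∃ s : Finset (Fin m → ℝ), tightFace f ∅ = convexHull ℝ (s : Set (Fin m → ℝ)) := by
  have hconv : Convex ℝ (tightFace f ∅) := by
    intro x hx y hy a b ha hb hab
    refine ⟨fun r => ?_, by simp⟩
    rw [Convex.combo_affine_apply hab]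
    exact add_nonneg (mul_nonneg ha (hx.1 r)) (mul_nonneg hb (hy.1 r))
  have hfin : (Set.extremePoints ℝ (tightFace f ∅)).Finite := by
    refine Set.Finite.of_finite_image (f := zeroSet f) (Set.toFinite _) ?_
    intro x hx y hy hxy
    by_contra hne
    set z : Fin m → ℝ := AffineMap.lineMap x y (-1 : ℝ) with hz
    have hz0 : ∀ r ∈ zeroSet f x, f r z = 0 := fun r hr => by
      have hr' : r ∈ zeroSet f y := hxy ▸ hr
      rw [hz, affine_lineMap_apply, show f r x = 0 from hr, show f r y = 0 from hr']; simp
    obtain ⟨t, ht, hf⟩ := exists_lineMap_feasible hx.1.1 (z := z) fun r hr => (hz0 r hr).ge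
    -- `x` lies strictly between `x - t (y - x)` and `y`
    have hseg : x ∈ openSegment ℝ (AffineMap.lineMap x z t) y := by
      refine ⟨1 / (1 + t), t / (1 + t), by positivity, by positivity, by field_simp, ?_⟩
      ext i
      simp only [hz, AffineMap.lineMap_apply_module, Pi.add_apply, Pi.smul_apply, smul_eq_mul]
      field_simp
      ring
    have := (mem_extremePoints.1 hx).2 _ ⟨hf, by simp⟩ y hy.1 hseg
    exact hne this.2.symm
  refine ⟨hfin.toFinset, ?_⟩
  rw [Set.Finite.coe_toFinset, ← hfin.isClosed_convexHull ℝ |>.closure_eq]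
  exact (closure_convexHull_extremePoints hcomp hconv).symm

lemma image_argmax {X Y : Type*} (π : X → Y) (P : Set X) (l : Y → ℝ) :
    π '' {x ∈ P | ∀ y ∈ P, l (π y) ≤ l (π x)} = {z ∈ π '' P | ∀ w ∈ π '' P, l w ≤ l z} := by
  ext z
  constructor
  · rintro ⟨x, hx, rfl⟩
    refine ⟨⟨x, hx.1, rfl⟩, ?_⟩
    rintro _ ⟨y, hy, rfl⟩
    exact hx.2 y hy
  · rintro ⟨⟨x, hx, rfl⟩, hmax⟩
    exact ⟨x, ⟨hx, fun y hy => hmax _ ⟨y, hy, rfl⟩⟩, rfl⟩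

/-- A linear image has the same face lattice if the map is injective on the directions of the
polytope: functionals on the polytope then factor through the image. -/
theorem combEquiv_image {m m' : ℕ} (π : (Fin m → ℝ) →ₗ[ℝ] (Fin m' → ℝ)) (P : Set (Fin m → ℝ))
    (hinj : ∀ w ∈ vectorSpan ℝ P, π w = 0 → w = 0) : CombEquiv (π '' P) P := by
  have hinj' : LinearMap.ker (π.domRestrict (vectorSpan ℝ P)) = ⊥ := by
    rw [LinearMap.ker_eq_bot']
    rintro ⟨w, hw⟩ h
    exact Subtype.ext (hinj w hw h)
  obtain ⟨σ, hσ⟩ := LinearMap.exists_leftInverse_of_injective _ hinj'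
  have hσ' : ∀ x ∈ P, ∀ y ∈ P, ((σ (π x) : Fin m → ℝ) - σ (π y)) = x - y := by
    intro x hx y hy
    have h := LinearMap.congr_fun hσ ⟨x - y, vsub_mem_vectorSpan ℝ hx hy⟩
    have h2 := congrArg Subtype.val h
    simpa using h2
  have hinjOn : Set.InjOn π P := fun x hx y hy h =>
    sub_eq_zero.1 (hinj _ (vsub_mem_vectorSpan ℝ hx hy) (by simp [h]))
  have hsub : ∀ F ∈ polytopeFaces P, F ⊆ P := fun F hF => IsExposed.subset hF
  let φ : polytopeFaces P → Set (Fin m' → ℝ) := fun F => π '' F.1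
  have hφ : ∀ F, φ F ∈ polytopeFaces (π '' P) := by
    rintro ⟨F, hF⟩ hne
    obtain ⟨l, hl⟩ := hF hne.of_image
    refine ⟨LinearMap.toContinuousLinearMap
      ((l : (Fin m → ℝ) →ₗ[ℝ] ℝ) ∘ₗ (vectorSpan ℝ P).subtype ∘ₗ σ), ?_⟩
    have hval : ∀ x ∈ P, ∀ y ∈ P, l (σ (π x)) ≤ l (σ (π y)) ↔ l x ≤ l y := by
      intro x hx y hy
      rw [← sub_nonpos, ← map_sub, hσ' x hx y hy, map_sub, sub_nonpos]
    ext z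
    constructor
    · rintro ⟨x, hx, rfl⟩
      simp only [hl] at hx
      refine ⟨⟨x, hx.1, rfl⟩, ?_⟩
      rintro _ ⟨y, hy, rfl⟩
      exact (hval y hy x hx.1).2 (hx.2 y hy)
    · rintro ⟨⟨x, hx, rfl⟩, hmax⟩
      refine ⟨x, ?_, rfl⟩
      simp only [hl]
      exact ⟨hx, fun y hy => (hval y hy x hx).1 (hmax _ ⟨y, hy, rfl⟩)⟩
  let g : polytopeFaces P ↪o polytopeFaces (π '' P) :=
    OrderEmbedding.ofMapLEIff (fun F => ⟨φ F, hφ F⟩) fun F F' => by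
      change π '' F.1 ⊆ π '' F'.1 ↔ F.1 ⊆ F'.1
      exact hinjOn.image_subset_image_iff (hsub _ F.2) (hsub _ F'.2)
  refine ⟨(RelIso.ofSurjective g ?_).symm⟩
  rintro ⟨F', hF'⟩
  rcases F'.eq_empty_or_nonempty with rfl | hne
  · exact ⟨⟨∅, fun h => absurd h Set.not_nonempty_empty⟩, Subtype.ext (Set.image_empty _)⟩
  obtain ⟨l, hl⟩ := hF' hne
  refine ⟨⟨{x ∈ P | ∀ y ∈ P, l (π y) ≤ l (π x)}, fun _ =>
    ⟨LinearMap.toContinuousLinearMap ((l : (Fin m' → ℝ) →ₗ[ℝ] ℝ) ∘ₗ π), rfl⟩⟩, Subtype.ext ?_⟩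
  change π '' _ = F'
  rw [hl]
  exact image_argmax π P l

lemma affDim_image_of_injective {m m' : ℕ} (π : (Fin m → ℝ) →ₗ[ℝ] (Fin m' → ℝ))
    (P : Set (Fin m → ℝ)) (hinj : ∀ w ∈ vectorSpan ℝ P, π w = 0 → w = 0) :
    affDim (π '' P) = affDim P := by
  have h : vectorSpan ℝ (π '' P) = (vectorSpan ℝ P).map π :=
    (AffineMap.map_vectorSpan π.toAffineMap (s := P)).symm
  unfold affDim
  rw [h, ← LinearMap.range_domRestrict]
  refine LinearMap.finrank_range_of_inj ?_
  rw [← LinearMap.ker_eq_bot, LinearMap.ker_eq_bot']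
  rintro ⟨w, hw⟩ h
  exact Subtype.ext (hinj w hw h)

/-! ### Systems with the equality sets of a cube -/

/-- A set of signed labels that contains at most one of `+i`, `-i` for every `i`. -/
def IsSignedSet {ι : Type*} (S : Set (ι × Bool)) : Prop :=
  ∀ i, ¬ ((i, true) ∈ S ∧ (i, false) ∈ S)

/-- The equality sets of the system `f` are those of the cube. -/
def IsCubeSystem {ι : Type*} {m : ℕ} (f : ι × Bool → (Fin m → ℝ) →ᵃ[ℝ] ℝ) : Prop :=
  ∀ S, IsEqualitySet f S ↔ IsSignedSet S

lemma IsSignedSet.anti {ι : Type*} {S T : Set (ι × Bool)} (hT : IsSignedSet T) (h : S ⊆ T) :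
    IsSignedSet S :=
  fun i hi => hT i ⟨h hi.1, h hi.2⟩

lemma isSignedSet_empty {ι : Type*} : IsSignedSet (∅ : Set (ι × Bool)) := fun _ h => h.1

lemma IsSignedSet.eq {ι : Type*} {S : Set (ι × Bool)} (hS : IsSignedSet S) {i : ι} {β γ : Bool}
    (h : (i, β) ∈ S) (h' : (i, γ) ∈ S) : β = γ := by
  cases β <;> cases γ
  · rfl
  · exact absurd ⟨h', h⟩ (hS i)
  · exact absurd ⟨h, h'⟩ (hS i)
  · rfl

lemma isSignedSet_of_eq {ι : Type*} {S : Set (ι × Bool)}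
    (h : ∀ i β γ, (i, β) ∈ S → (i, γ) ∈ S → β = γ) : IsSignedSet S :=
  fun i hi => Bool.noConfusion (h i _ _ hi.1 hi.2)

lemma IsSignedSet.injOn_fst {ι : Type*} {S : Set (ι × Bool)} (hS : IsSignedSet S) :
    Set.InjOn Prod.fst S := by
  rintro ⟨i, β⟩ h ⟨j, γ⟩ h' (rfl : i = j)
  rw [hS.eq h h']

lemma IsSignedSet.insert {ι : Type*} {S : Set (ι × Bool)} (hS : IsSignedSet S) {i : ι}
    (hi : ∀ β, (i, β) ∉ S) (γ : Bool) : IsSignedSet (insert (i, γ) S) := by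
  refine isSignedSet_of_eq fun j β β' h h' => ?_
  rcases h with h | h <;> rcases h' with h' | h'
  · exact (Prod.ext_iff.1 h).2.trans (Prod.ext_iff.1 h').2.symm
  · cases h; exact absurd h' (hi _)
  · cases h'; exact absurd h (hi _)
  · exact hS.eq h h'

lemma exists_label_not_mem {n : ℕ} {S : Set (Fin n × Bool)} (h : S.ncard < n) :
    ∃ i, ∀ β, (i, β) ∉ S := by
  by_contra! hcon
  have h1 : (Set.univ : Set (Fin n)) ⊆ Prod.fst '' S := fun i _ => by
    obtain ⟨β, hβ⟩ := hcon i
    exact ⟨_, hβ, rfl⟩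
  have h2 := Set.ncard_le_ncard h1 (Set.toFinite _)
  rw [Set.ncard_univ, Nat.card_eq_fintype_card, Fintype.card_fin] at h2
  have h3 := Set.ncard_image_le (f := Prod.fst) (Set.toFinite S)
  omega

/-- A signed set can be enlarged one label at a time until it contains a label for every index. -/
lemma IsSignedSet.exists_superset {n : ℕ} {S : Set (Fin n × Bool)} (hS : IsSignedSet S) {k : ℕ}
    (h : S.ncard ≤ k) (hk : k ≤ n) : ∃ T, IsSignedSet T ∧ S ⊆ T ∧ T.ncard = k := by
  induction k with
  | zero => exact ⟨S, hS, subset_rfl, by omega⟩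
  | succ k ih =>
    rcases h.eq_or_lt with h | h
    · exact ⟨S, hS, subset_rfl, h⟩
    · obtain ⟨T, hT, hST, hc⟩ := ih (by omega) (by omega)
      obtain ⟨i, hi⟩ := exists_label_not_mem (S := T) (by omega)
      refine ⟨_, hT.insert hi true, hST.trans (Set.subset_insert _ _), ?_⟩
      rw [Set.ncard_insert_of_notMem (hi _) (Set.toFinite T), hc]

lemma le_ncard_add_affDim {n m : ℕ} {f : Fin n × Bool → (Fin m → ℝ) →ᵃ[ℝ] ℝ}
    (hf : IsCubeSystem f) {S : Set (Fin n × Bool)} (hS : IsSignedSet S) :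
    n ≤ S.ncard + affDim (tightFace f S) := by
  induction hk : n - S.ncard generalizing S with
  | zero => omega
  | succ k ih =>
    obtain ⟨i, hi⟩ := exists_label_not_mem (S := S) (by omega)
    have hT := hS.insert hi true
    have hc := Set.ncard_insert_of_notMem (hi true) (Set.toFinite S)
    have h1 := ih hT (by omega)
    have h2 := affDim_tightFace_lt ((hf _).2 hS) ((hf _).2 hT) (Set.ssubset_insert (hi true))
    omega

lemma affDim_add_ncard_le {n : ℕ} {f : Fin n × Bool → (Fin n → ℝ) →ᵃ[ℝ] ℝ}
    (hf : IsCubeSystem f) {S : Set (Fin n × Bool)} (hS : IsSignedSet S) :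
    affDim (tightFace f S) + S.ncard ≤ n := by
  induction S, Set.toFinite S using Set.Finite.induction_on with
  | empty =>
    rw [Set.ncard_empty]
    exact (Submodule.finrank_le _).trans (by simp)
  | @insert a S ha _ ih =>
    have hS' := hS.anti (Set.subset_insert a S)
    have h1 := ih hS'
    have hc := Set.ncard_insert_of_notMem ha (Set.toFinite S)
    have h2 := affDim_tightFace_lt ((hf _).2 hS') ((hf _).2 hS) (Set.ssubset_insert ha)
    omega

/-- The faces of a cube have the expected dimension: along a chain of faces from the cube down to
a vertex the dimension drops in each of the `n` steps, and it is at most `n` at the start. -/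
theorem affDim_tightFace_add_ncard {n : ℕ} {f : Fin n × Bool → (Fin n → ℝ) →ᵃ[ℝ] ℝ}
    (hf : IsCubeSystem f) {S : Set (Fin n × Bool)} (hS : IsSignedSet S) :
    affDim (tightFace f S) + S.ncard = n :=
  le_antisymm (affDim_add_ncard_le hf hS) (by rw [add_comm]; exact le_ncard_add_affDim hf hS)

/-- The signed sets above a given one are the signed sets on the remaining indices. -/
lemma nonempty_signedSet_orderIso {ι κ : Type*} {S : Set (ι × Bool)} (hS : IsSignedSet S)
    (e : κ ≃ {i : ι // ∀ β, (i, β) ∉ S}) :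
    Nonempty ({T : Set (ι × Bool) // IsSignedSet T ∧ S ⊆ T} ≃o
      {T : Set (κ × Bool) // IsSignedSet T}) := by
  let g : {T : Set (ι × Bool) // IsSignedSet T ∧ S ⊆ T} ↪o {T : Set (κ × Bool) // IsSignedSet T} :=
    OrderEmbedding.ofMapLEIff
      (fun T => ⟨{p | ((e p.1 : ι), p.2) ∈ T.1},
        isSignedSet_of_eq fun i β γ h h' => T.2.1.eq h h'⟩) fun T T' => by
      constructor
      · rintro h ⟨i, β⟩ hT
        by_cases hi : ∀ β, (i, β) ∉ S
        · have := @h (e.symm ⟨i, hi⟩, β)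
          simp only [Set.mem_ofPred_eq, Equiv.apply_symm_apply] at this
          exact this hT
        · push Not at hi
          obtain ⟨γ, hγ⟩ := hi
          rw [T.2.1.eq hT (T.2.2 hγ)]
          exact T'.2.2 hγ
      · exact fun h p hp => h hp
  refine ⟨RelIso.ofSurjective g ?_⟩
  rintro ⟨T', hT'⟩
  refine ⟨⟨S ∪ {p | ∃ h : ∀ β, (p.1, β) ∉ S, (e.symm ⟨p.1, h⟩, p.2) ∈ T'},
    isSignedSet_of_eq fun i β γ h h' => ?_, Set.subset_union_left⟩, Subtype.ext ?_⟩
  · rcases h with h | ⟨h1, h⟩ <;> rcases h' with h' | ⟨h1', h'⟩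
    · exact hS.eq h h'
    · exact absurd h (h1' _)
    · exact absurd h' (h1 _)
    · exact hT'.eq h h'
  · change {p : κ × Bool | _} = T'
    ext ⟨j, β⟩
    constructor
    · rintro (h | ⟨h1, h⟩)
      · exact absurd h ((e j).2 β)
      · simpa using h
    · intro h
      exact Or.inr ⟨(e j).2, by simpa using h⟩

/-- The slack functions `1 - x i` and `x i` of the standard cube. -/
def stdCubeSystem (n : ℕ) (r : Fin n × Bool) : (Fin n → ℝ) →ᵃ[ℝ] ℝ :=
  if r.2 then AffineMap.const ℝ _ 1 - (LinearMap.proj r.1 : (Fin n → ℝ) →ₗ[ℝ] ℝ).toAffineMap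
  else (LinearMap.proj r.1 : (Fin n → ℝ) →ₗ[ℝ] ℝ).toAffineMap

lemma stdCubeSystem_true {n : ℕ} (i : Fin n) (x : Fin n → ℝ) :
    stdCubeSystem n (i, true) x = 1 - x i := by
  simp [stdCubeSystem]

lemma stdCubeSystem_false {n : ℕ} (i : Fin n) (x : Fin n → ℝ) :
    stdCubeSystem n (i, false) x = x i := by
  simp [stdCubeSystem]

lemma stdCube_eq_tightFace (n : ℕ) : stdCube n = tightFace (stdCubeSystem n) ∅ := by
  ext x
  simp only [stdCube, Set.mem_Icc, Pi.le_def, tightFace, Set.mem_ofPred_eq, Set.empty_subset,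
    and_true, Prod.forall, Bool.forall_bool, stdCubeSystem_true, stdCubeSystem_false,
    Pi.zero_apply, Pi.one_apply, sub_nonneg, forall_and]

lemma isCubeSystem_stdCubeSystem (n : ℕ) : IsCubeSystem (stdCubeSystem n) := by
  classical
  intro S
  constructor
  · rintro ⟨x, hx, rfl⟩ i ⟨h1, h2⟩
    have h1' : stdCubeSystem n (i, true) x = 0 := h1
    have h2' : stdCubeSystem n (i, false) x = 0 := h2
    rw [stdCubeSystem_true] at h1'
    rw [stdCubeSystem_false] at h2'
    linarith
  · intro hS
    let x : Fin n → ℝ := fun i =>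
      if (i, true) ∈ S then 1 else if (i, false) ∈ S then 0 else 1 / 2
    have hx : ∀ i, x i = if (i, true) ∈ S then 1 else if (i, false) ∈ S then 0 else 1 / 2 :=
      fun i => rfl
    refine ⟨x, ?_, ?_⟩
    · rintro ⟨i, β⟩
      cases β
      · rw [stdCubeSystem_false, hx]; split_ifs <;> norm_num
      · rw [stdCubeSystem_true, hx]; split_ifs <;> norm_num
    · ext ⟨i, β⟩
      change stdCubeSystem n (i, β) x = 0 ↔ _
      have hSi := hS i
      cases β
      · rw [stdCubeSystem_false, hx]
        split_ifs with h1 h2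
        · simp only [one_ne_zero, false_iff]; tauto
        · simpa using h2
        · simpa using h2
      · rw [stdCubeSystem_true, hx]
        split_ifs with h1 h2
        · simpa using h1
        · simpa using h1
        · simp only [h1, iff_false]; norm_num

/-- Every face of a polytope with the equality sets of a cube is a combinatorial cube. -/
theorem combEquiv_tightFace_stdCube {n m k : ℕ} {f : Fin n × Bool → (Fin m → ℝ) →ᵃ[ℝ] ℝ}
    (hf : IsCubeSystem f) {S : Set (Fin n × Bool)} (hS : IsSignedSet S)
    (e : Fin k ≃ {i : Fin n // ∀ β, (i, β) ∉ S}) :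
    CombEquiv (tightFace f S) (stdCube k) := by
  obtain ⟨e₁⟩ := nonempty_polytopeFaces_orderIso f S
  obtain ⟨e₂⟩ := nonempty_polytopeFaces_orderIso (stdCubeSystem k) ∅
  obtain ⟨e₃⟩ := nonempty_signedSet_orderIso hS e
  rw [← stdCube_eq_tightFace] at e₂
  let a₁ : {T // IsEqualitySet f T ∧ S ⊆ T} ≃o {T : Set (Fin n × Bool) // IsSignedSet T ∧ S ⊆ T} :=
    { toEquiv := Equiv.subtypeEquivRight fun T => and_congr_left' (hf T)
      map_rel_iff' := Iff.rfl }
  let a₂ : {T // IsEqualitySet (stdCubeSystem k) T ∧ ∅ ⊆ T} ≃o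
      {T : Set (Fin k × Bool) // IsSignedSet T} :=
    { toEquiv := Equiv.subtypeEquivRight fun T => by
        rw [isCubeSystem_stdCubeSystem k T]; simp
      map_rel_iff' := Iff.rfl }
  exact ⟨e₁.symm.trans (((a₁.trans e₃).trans a₂.symm).dual.withBotCongr.trans e₂)⟩

theorem exists_combEquiv_tightFace_stdCube {n m : ℕ} {f : Fin n × Bool → (Fin m → ℝ) →ᵃ[ℝ] ℝ}
    (hf : IsCubeSystem f) {S : Set (Fin n × Bool)} (hS : IsSignedSet S) :
    ∃ k, CombEquiv (tightFace f S) (stdCube k) :=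
  ⟨_, combEquiv_tightFace_stdCube hf hS (Finite.equivFin _).symm⟩

/-- The signed sets that correspond to the faces of dimension at most `k` of the `n`-cube, ordered
like these faces. -/
abbrev SkeletonIndex (n k : ℕ) :=
  {S : Set (Fin n × Bool) // IsSignedSet S ∧ n ≤ S.ncard + k}ᵒᵈ

/-- Recognition of the `k`-skeleton of the `n`-cube: the faces of dimension at most `k` are indexed
by the signed sets of at least `n - k` labels in an order-reversing way. -/
theorem nonempty_skeletonIndex_orderIso {n m k : ℕ} {P : Set (Fin m → ℝ)}
    (φ : Set (Fin n × Bool) → Set (Fin m → ℝ))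
    (hφ : ∀ S, IsSignedSet S → n ≤ S.ncard + k →
      (φ S).Nonempty ∧ IsExposed ℝ P (φ S) ∧ affDim (φ S) ≤ k)
    (hsurj : ∀ F, IsExposed ℝ P F → F.Nonempty → affDim F ≤ k →
      ∃ S, IsSignedSet S ∧ n ≤ S.ncard + k ∧ F = φ S)
    (hle : ∀ S T, IsSignedSet S → n ≤ S.ncard + k → IsSignedSet T → n ≤ T.ncard + k →
      (φ S ⊆ φ T ↔ T ⊆ S)) :
    Nonempty (WithBot (SkeletonIndex n k) ≃o skeletonFaces k P) := by
  refine nonempty_withBot_orderIso _ (fun S => φ (OrderDual.ofDual S).1) ?_ ?_ ?_ ?_ ?_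
  · refine ⟨fun h => absurd h Set.not_nonempty_empty, ?_⟩
    rw [affDim, vectorSpan_empty, finrank_bot]
    exact Nat.zero_le k
  · exact fun S => (hφ S.1 S.2.1 S.2.2).2
  · exact fun S => (hφ S.1 S.2.1 S.2.2).1
  · rintro F ⟨hF, hd⟩ hne
    obtain ⟨S, h1, h2, h3⟩ := hsurj F hF hne hd
    exact ⟨OrderDual.toDual ⟨S, h1, h2⟩, h3⟩
  · exact fun S T => hle _ _ S.2.1 S.2.2 T.2.1 T.2.2

theorem nonempty_skeletonFaces_tightFace_orderIso {n : ℕ} (k : ℕ)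
    {f : Fin n × Bool → (Fin n → ℝ) →ᵃ[ℝ] ℝ} (hf : IsCubeSystem f) :
    Nonempty (WithBot (SkeletonIndex n k) ≃o skeletonFaces k (tightFace f ∅)) := by
  refine nonempty_skeletonIndex_orderIso (tightFace f) ?_ ?_ ?_
  · intro S hS hk
    have hne := ((hf S).2 hS).nonempty
    refine ⟨hne, isExposed_tightFace (Set.empty_subset S) hne, ?_⟩
    have := affDim_tightFace_add_ncard hf hS
    omega
  · intro F hF hne hd
    obtain ⟨S, hS, -, rfl⟩ := exists_eq_tightFace_of_isExposed hF hne
    have hS' := (hf S).1 hS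
    have := affDim_tightFace_add_ncard hf hS'
    exact ⟨S, hS', by omega, rfl⟩
  · exact fun S T hS _ _ _ => ((hf S).2 hS).tightFace_subset_iff

/-! ### Systems of linear inequalities: positive dependences and perturbation -/

/-- **Stiemke's lemma**: if no element of the range of `y ↦ (u j y)` is nonnegative and nonzero,
then the `u j` have a linear dependence with positive coefficients. The coefficients come from a
hyperplane that contains the range and misses the standard simplex. -/
lemma exists_pos_dependence {J V : Type*} [Fintype J] [AddCommGroup V] [Module ℝ V]
    (u : J → V →ₗ[ℝ] ℝ) (h : ∀ y, (∀ j, 0 ≤ u j y) → ∀ j, u j y = 0) :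
    ∃ c : J → ℝ, (∀ j, 0 < c j) ∧ ∀ y, ∑ j, c j * u j y = 0 := by
  classical
  let W : Submodule ℝ (J → ℝ) := LinearMap.range (LinearMap.pi u)
  have hdisj : Disjoint (stdSimplex ℝ J) (W : Set (J → ℝ)) := by
    rw [Set.disjoint_left]
    rintro x hx ⟨y, rfl⟩
    have h0 := h y fun j => hx.1 j
    have h1 := hx.2
    simp [h0] at h1
  obtain ⟨f, a, b, ha, hab, hb⟩ := geometric_hahn_banach_compact_closed (convex_stdSimplex ℝ J)
    (isCompact_stdSimplex ℝ J) W.convex W.closed_of_finiteDimensional hdisj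
  have hb0 : b < 0 := by simpa using hb 0 W.zero_mem
  -- a functional that is bounded below on a subspace vanishes there
  have hfW : ∀ w ∈ W, f w = 0 := by
    intro w hw
    by_contra hne
    have := hb ((b / f w) • w) (W.smul_mem _ hw)
    rw [map_smul, smul_eq_mul, div_mul_cancel₀ _ hne] at this
    exact lt_irrefl _ this
  refine ⟨fun j => - f (Pi.single j 1), fun j => ?_, fun y => ?_⟩
  · have := ha _ (single_mem_stdSimplex ℝ j)
    linarith
  · have h1 := hfW (LinearMap.pi u y) ⟨y, rfl⟩
    rw [pi_eq_sum_univ' (LinearMap.pi u y), map_sum] at h1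
    simp only [map_smul, smul_eq_mul, LinearMap.pi_apply] at h1
    simp only [neg_mul, Finset.sum_neg_distrib, neg_eq_zero]
    rw [← h1]
    exact Finset.sum_congr rfl fun j _ => mul_comm _ _

/-- If at every nonzero `y` one of the finitely many functionals `u j` is positive, then this holds
with a margin that is proportional to `‖y‖`. -/
lemma exists_margin {J : Type*} [Finite J] {k : ℕ} (u : J → (Fin k → ℝ) →ₗ[ℝ] ℝ)
    (h : ∀ y, y ≠ 0 → ∃ j, 0 < u j y) :
    ∃ c : ℝ, 0 < c ∧ ∀ y, y ≠ 0 → ∃ j, c * ‖y‖ < u j y := by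
  have := Fintype.ofFinite J
  have hcont : Continuous fun y : Fin k → ℝ => ∑ j, max (u j y) 0 :=
    continuous_finsetSum _ fun j _ =>
      (u j).continuous_of_finiteDimensional.max continuous_const
  rcases (Metric.sphere (0 : Fin k → ℝ) 1).eq_empty_or_nonempty with hemp | hne
  · refine ⟨1, one_pos, fun y hy => absurd ?_ (Set.eq_empty_iff_forall_notMem.1 hemp (‖y‖⁻¹ • y))⟩
    rw [mem_sphere_zero_iff_norm, norm_smul, norm_inv, norm_norm,
      inv_mul_cancel₀ (norm_ne_zero_iff.2 hy)]
  obtain ⟨y₀, hy₀, hmin⟩ := (isCompact_sphere (0 : Fin k → ℝ) 1).exists_isMinOn hne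
    hcont.continuousOn
  have hpos : 0 < ∑ j, max (u j y₀) 0 := by
    obtain ⟨j, hj⟩ := h y₀ (ne_zero_of_mem_unit_sphere ⟨y₀, hy₀⟩)
    exact Finset.sum_pos' (fun _ _ => le_max_right _ _) ⟨j, Finset.mem_univ _, lt_max_of_lt_left hj⟩
  set s := ∑ j, max (u j y₀) 0 with hs
  have hcard : (0 : ℝ) < Fintype.card J + 1 := by positivity
  refine ⟨s / (Fintype.card J + 1), by positivity, fun y hy => ?_⟩
  by_contra! hcon
  have hny : 0 < ‖y‖ := norm_pos_iff.2 hy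
  have hz : ‖y‖⁻¹ • y ∈ Metric.sphere (0 : Fin k → ℝ) 1 := by
    rw [mem_sphere_zero_iff_norm, norm_smul, norm_inv, norm_norm, inv_mul_cancel₀ hny.ne']
  have h1 : s ≤ ∑ j, max (u j (‖y‖⁻¹ • y)) 0 := hmin hz
  have h2 : ∑ j, max (u j (‖y‖⁻¹ • y)) 0 ≤ ∑ _j : J, s / (Fintype.card J + 1) := by
    refine Finset.sum_le_sum fun j _ => max_le ?_ (by positivity)
    rw [map_smul, smul_eq_mul, inv_mul_le_iff₀ hny, mul_comm]
    exact hcon j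
  rw [Finset.sum_const, Finset.card_univ, nsmul_eq_mul] at h2
  have h3 : (Fintype.card J : ℝ) * (s / (Fintype.card J + 1)) < s := by
    rw [mul_div_assoc', div_lt_iff₀ hcard]; nlinarith
  linarith

/-- The two-sided variant of `exists_margin` for functionals without a common zero. -/
lemma exists_margin_abs {J : Type*} [Finite J] {k : ℕ} (u : J → (Fin k → ℝ) →ₗ[ℝ] ℝ)
    (h : ∀ y, (∀ j, u j y = 0) → y = 0) :
    ∃ c : ℝ, 0 < c ∧ ∀ y, y ≠ 0 → ∃ j, c * ‖y‖ < |u j y| := by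
  obtain ⟨c, hc, hm⟩ := exists_margin (fun p : J × Bool => if p.2 then u p.1 else - u p.1)
    fun y hy => by
      by_contra! hcon
      refine hy (h y fun j => ?_)
      have h1 := hcon (j, true)
      have h2 := hcon (j, false)
      simp at h1 h2
      linarith
  refine ⟨c, hc, fun y hy => ?_⟩
  obtain ⟨⟨j, β⟩, hj⟩ := hm y hy
  refine ⟨j, hj.trans_le ?_⟩
  cases β
  · simpa using neg_le_abs (u j y)
  · simpa using le_abs_self (u j y)

/-! ### Gale transforms of neighborly configurations -/

lemma vecMul_homogenization_eq_zero_iff {m e : ℕ} (v : Fin m → Fin e → ℝ) (w : Fin m → ℝ) :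
    Matrix.vecMul w (homogenization v) = 0 ↔ ∑ i, w i = 0 ∧ ∑ i, w i • v i = 0 := by
  constructor
  · intro h
    refine ⟨?_, ?_⟩
    · have := congrFun h (Sum.inr ())
      simpa [homogenization, Matrix.vecMul, dotProduct] using this
    · ext j
      have := congrFun h (Sum.inl j)
      simpa [homogenization, Matrix.vecMul, dotProduct] using this
  · rintro ⟨h1, h2⟩
    ext (j | j)
    · have := congrFun h2 j
      simpa [homogenization, Matrix.vecMul, dotProduct] using this
    · simpa [homogenization, Matrix.vecMul, dotProduct] using h1

/-- Points in general position have no affine dependence with a support of at most `e + 1`. -/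
lemma IsNeighborlyGeneral.eq_zero_of_support {m e : ℕ} {v : Fin m → Fin e → ℝ}
    (hv : IsNeighborlyGeneral v) (hm : e + 1 ≤ m) {I : Finset (Fin m)} (hI : I.card ≤ e + 1)
    {w : Fin m → ℝ} (hw : Matrix.vecMul w (homogenization v) = 0) (hsupp : ∀ i ∉ I, w i = 0) :
    w = 0 := by
  obtain ⟨I', hII', hcard⟩ := Finset.exists_superset_card_eq hI (by simpa using hm)
  rw [vecMul_homogenization_eq_zero_iff] at hw
  have hz : ∀ i ∉ I', w i = 0 := fun i hi => hsupp i fun h => hi (hII' h)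
  have h := (affineIndependent_iff.1 (hv.general_position I' hcard)) Finset.univ (fun i => w i)
    (by
      rw [← hw.1, Finset.sum_coe_sort I' w]
      exact Finset.sum_subset (Finset.subset_univ _) fun i _ hi => hz i hi)
    (by
      rw [← hw.2, Finset.sum_coe_sort I' fun i => w i • v i]
      exact Finset.sum_subset (Finset.subset_univ _) fun i _ hi => by rw [hz i hi, zero_smul])
  ext i
  by_cases hi : i ∈ I'
  · exact h ⟨i, hi⟩ (Finset.mem_univ _)
  · exact hz i hi

lemma IsGaleTransform.vecMul_mulVec {m e k : ℕ} {v : Fin m → Fin e → ℝ}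
    {G : Matrix (Fin m) (Fin k) ℝ} (hG : IsGaleTransform v G) (x : Fin k → ℝ) :
    Matrix.vecMul (G.mulVec x) (homogenization v) = 0 := by
  rw [← hG.span_col, ← Matrix.range_mulVecLin]
  exact ⟨x, rfl⟩

lemma IsGaleTransform.eq_zero_of_mulVec {m e k : ℕ} {v : Fin m → Fin e → ℝ}
    {G : Matrix (Fin m) (Fin k) ℝ} (hG : IsGaleTransform v G) {x : Fin k → ℝ}
    (h : G.mulVec x = 0) : x = 0 :=
  Matrix.mulVec_injective_iff.2 hG.linearIndependent (by rw [h, Matrix.mulVec_zero])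

/-- General position of the points: any `k` rows of the Gale transform span. -/
lemma IsGaleTransform.eq_zero_of_rows {m e k : ℕ} {v : Fin m → Fin e → ℝ}
    {G : Matrix (Fin m) (Fin k) ℝ} (hv : IsNeighborlyGeneral v) (hG : IsGaleTransform v G)
    (hm : m = k + (e + 1)) {T : Finset (Fin m)} (hT : k ≤ T.card) {x : Fin k → ℝ}
    (hx : ∀ t ∈ T, G.mulVec x t = 0) : x = 0 := by
  refine hG.eq_zero_of_mulVec (hv.eq_zero_of_support (by omega) (I := Tᶜ) ?_
    (hG.vecMul_mulVec x) fun i hi => hx i (by simpa using hi))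
  rw [Finset.card_compl, Fintype.card_fin]
  omega

/-- Neighborliness of the points: the rows of the Gale transform outside a small index set span
positively. -/
lemma IsGaleTransform.eq_zero_of_nonneg {m e k : ℕ} {v : Fin m → Fin e → ℝ}
    {G : Matrix (Fin m) (Fin k) ℝ} (hv : IsNeighborlyGeneral v) (hG : IsGaleTransform v G)
    (hm : e + 1 ≤ m) {I : Finset (Fin m)} (hI : I.card ≤ e / 2) {x : Fin k → ℝ}
    (hx : ∀ t ∉ I, 0 ≤ G.mulVec x t) : x = 0 := by
  set w := G.mulVec x with hw
  have hw0 := hG.vecMul_mulVec x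
  rw [← hw] at hw0
  have hsum := (vecMul_homogenization_eq_zero_iff v w).1 hw0
  obtain ⟨F, hF, hFI⟩ := hv.neighborly I hI
  refine hG.eq_zero_of_mulVec (hv.eq_zero_of_support hm (I := I) (by omega) hw0 ?_)
  rcases F.eq_empty_or_nonempty with rfl | hne
  · have hI0 : ∀ i, i ∉ I := fun i hi => (hFI i).2 hi
    intro i hi
    exact (Finset.sum_eq_zero_iff_of_nonneg fun j _ => hx j (hI0 j)).1 hsum.1 i (Finset.mem_univ _)
  · obtain ⟨l, rfl⟩ := hF hne
    obtain ⟨p, hp, hmax⟩ := hne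
    -- the supporting functional gives nonnegative heights, which vanish exactly on the face
    have hv_mem : ∀ i, v i ∈ convexHull ℝ (Set.range v) := fun i =>
      subset_convexHull ℝ _ ⟨i, rfl⟩
    have hheight : ∀ i, l (v i) = l p ↔ i ∈ I := fun i => by
      rw [← hFI i]
      exact ⟨fun h => ⟨hv_mem i, fun y hy => h ▸ hmax y hy⟩,
        fun h => le_antisymm (hmax _ (hv_mem i)) (h.2 p hp)⟩
    have hs : ∑ i, w i * (l p - l (v i)) = 0 := by
      have h2 := congrArg l hsum.2
      simp only [map_sum, map_smul, smul_eq_mul, map_zero] at h2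
      simp only [mul_sub, Finset.sum_sub_distrib, ← Finset.sum_mul, hsum.1, h2]
      simp
    have hnn : ∀ i ∈ Finset.univ, 0 ≤ w i * (l p - l (v i)) := fun i _ => by
      by_cases hi : i ∈ I
      · rw [(hheight i).2 hi]; simp
      · exact mul_nonneg (hx i hi) (sub_nonneg.2 (hmax _ (hv_mem i)))
    intro i hi
    refine (mul_eq_zero.1 ((Finset.sum_eq_zero_iff_of_nonneg hnn).1 hs i
      (Finset.mem_univ _))).resolve_right fun h => hi ((hheight i).1 (sub_eq_zero.1 h).symm)

lemma stackIdentity_mulVec {n d : ℕ} (g : Matrix (Fin (d - 1)) (Fin (n - d)) ℝ)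
    (x : Fin (n - d) → ℝ) (i : Fin (n - 1)) :
    (stackIdentity g).mulVec x i =
      if h : n - d ≤ i.val then g.mulVec x ⟨i.val - (n - d), by omega⟩
      else x ⟨i.val, by omega⟩ := by
  split_ifs with h
  · simp [Matrix.mulVec, dotProduct, stackIdentity, h]
  · have : ∀ j : Fin (n - d), (i.val = j.val) = (⟨i.val, by omega⟩ = j) := fun j => by
      rw [Fin.ext_iff]
    simp [Matrix.mulVec, dotProduct, stackIdentity, h, this]

/-- A configuration in general position has a Gale transform that starts with the identity: the
last points are an affine basis, in which all the others can be expressed. -/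
theorem exists_isGaleTransform_stackIdentity {n d : ℕ} (hd : 2 ≤ d) (hdn : d ≤ n)
    {v : Fin (n - 1) → Fin (d - 2) → ℝ} (hv : IsNeighborlyGeneral v) :
    ∃ g : Matrix (Fin (d - 1)) (Fin (n - d)) ℝ, IsGaleTransform v (stackIdentity g) := by
  let I : Finset (Fin (n - 1)) := Finset.univ.filter fun i => n - d ≤ i.val
  have hI : I.card ≤ d - 2 + 1 := by
    have : I ⊆ (Finset.univ : Finset (Fin (d - 1))).image
        fun i => (⟨n - d + i.val, by omega⟩ : Fin (n - 1)) := fun i hi => by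
      have hi' : n - d ≤ i.val := (Finset.mem_filter.1 hi).2
      refine Finset.mem_image.2 ⟨⟨i.val - (n - d), by omega⟩, Finset.mem_univ _, ?_⟩
      ext
      change n - d + (i.val - (n - d)) = i.val
      omega
    have h2 := (Finset.card_le_card this).trans Finset.card_image_le
    rw [Finset.card_univ, Fintype.card_fin] at h2
    omega
  have hindep : ∀ w : Fin (n - 1) → ℝ, Matrix.vecMul w (homogenization v) = 0 →
      (∀ i : Fin (n - 1), i.val < n - d → w i = 0) → w = 0 := fun w hw hs =>
    hv.eq_zero_of_support (by omega) hI hw fun i hi => hs i (by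
      simp only [I, Finset.mem_filter, Finset.mem_univ, true_and] at hi; omega)
  let ext : (Fin (d - 1) → ℝ) →ₗ[ℝ] (Fin (n - 1) → ℝ) :=
    { toFun := fun c i => if h : n - d ≤ i.val then c ⟨i.val - (n - d), by omega⟩ else 0
      map_add' := fun c c' => by
        ext i; simp only [Pi.add_apply]; split_ifs <;> simp
      map_smul' := fun a c => by
        ext i; simp only [Pi.smul_apply, RingHom.id_apply]; split_ifs <;> simp }
  have hext : ∀ c i, ext c i = if h : n - d ≤ i.val then c ⟨i.val - (n - d), by omega⟩ else 0 :=
    fun _ _ => rfl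
  let L := (homogenization v).vecMulLinear ∘ₗ ext
  have hL : Function.Injective L := by
    rw [← LinearMap.ker_eq_bot, LinearMap.ker_eq_bot']
    intro c hc
    have h0 := hindep (ext c) hc fun i hi => by rw [hext, dif_neg (by omega)]
    ext i
    have := congrFun h0 ⟨n - d + i.val, by omega⟩
    simpa [hext] using this
  have hLs : Function.Surjective L :=
    (LinearMap.injective_iff_surjective_of_finrank_eq_finrank (by simp; omega)).1 hL
  choose c hc using fun j : Fin (n - d) =>
    hLs (- Matrix.vecMul (Pi.single ⟨j.val, by omega⟩ 1) (homogenization v))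
  let g : Matrix (Fin (d - 1)) (Fin (n - d)) ℝ := Matrix.of fun i j => c j i
  have hcol : ∀ j, (stackIdentity g).col j = Pi.single ⟨j.val, by omega⟩ 1 + ext (c j) := by
    intro j
    ext i
    by_cases h : n - d ≤ i.val
    · have hne : i ≠ ⟨j.val, by omega⟩ := fun h' => by rw [h'] at h; simp at h; omega
      simp [Matrix.col, stackIdentity, h, hext, g, hne]
    · simp [Matrix.col, stackIdentity, h, hext, Pi.single_apply, Fin.ext_iff]
  have hcol0 : ∀ j, Matrix.vecMul ((stackIdentity g).col j) (homogenization v) = 0 := by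
    intro j
    rw [hcol, Matrix.add_vecMul]
    have := hc j
    change Matrix.vecMul (ext (c j)) (homogenization v) = _ at this
    rw [this, add_neg_cancel]
  have hmul0 : ∀ x, Matrix.vecMul ((stackIdentity g).mulVec x) (homogenization v) = 0 := by
    intro x
    have h : (stackIdentity g).mulVec x ∈ Submodule.span ℝ (Set.range (stackIdentity g).col) := by
      rw [← Matrix.range_mulVecLin]; exact ⟨x, rfl⟩
    have hle : Submodule.span ℝ (Set.range (stackIdentity g).col) ≤
        LinearMap.ker (homogenization v).vecMulLinear := by
      rw [Submodule.span_le]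
      rintro _ ⟨j, rfl⟩
      exact hcol0 j
    exact hle h
  have htop : ∀ (x : Fin (n - d) → ℝ) (i : Fin (n - 1)) (hi : i.val < n - d),
      (stackIdentity g).mulVec x i = x ⟨i.val, hi⟩ := fun x i hi => by
    rw [stackIdentity_mulVec, dif_neg (by omega)]
  refine ⟨g, ⟨?_, fun w => ⟨fun hw => ?_, fun hw => ?_⟩⟩⟩
  · rw [← Matrix.mulVec_injective_iff]
    intro x y hxy
    ext j
    have := congrFun hxy ⟨j.val, by omega⟩
    rwa [htop x _ j.2, htop y _ j.2] at this
  · rw [← Matrix.range_mulVecLin] at hw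
    obtain ⟨x, rfl⟩ := hw
    exact hmul0 x
  · have h0 := hindep (w - (stackIdentity g).mulVec fun j => w ⟨j.val, by omega⟩)
      (by rw [Matrix.sub_vecMul, hw, hmul0, sub_zero])
      fun i hi => by rw [Pi.sub_apply, htop _ i hi, sub_self]
    rw [sub_eq_zero.1 h0, ← Matrix.range_mulVecLin]
    exact ⟨_, rfl⟩

/-! ### The moment curve -/

/-- Points on the moment curve with natural parameters. -/
def momentCurve (m e : ℕ) (i : Fin m) (j : Fin e) : ℝ := (i.val : ℝ) ^ (j.val + 1)

lemma eval_eq_coeff_zero_add_sum {e : ℕ} (p : Polynomial ℝ) (hp : p.natDegree ≤ e) (t : ℝ) :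
    p.eval t = p.coeff 0 + ∑ j : Fin e, p.coeff (j.val + 1) * t ^ (j.val + 1) := by
  rw [Polynomial.eval_eq_sum_range' (Nat.lt_succ_of_le hp), Finset.sum_range_succ',
    Finset.sum_range fun j => p.coeff (j + 1) * t ^ (j + 1)]
  simp [add_comm]

/-- Points on the moment curve form a neighborly configuration: a dependence between `e + 1` of
them contradicts the interpolation of a polynomial of degree `e`, and the polynomial
`∏ (t - t_i) ^ 2` over a small index set is a functional that supports exactly the points
in this set. -/
theorem isNeighborlyGeneral_momentCurve (m e : ℕ) : IsNeighborlyGeneral (momentCurve m e) := by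
  classical
  have hinj : Function.Injective fun i : Fin m => (i.val : ℝ) := fun i j h =>
    Fin.ext (Nat.cast_injective h)
  constructor
  · intro I hI
    rw [affineIndependent_iff]
    intro s w hw0 hw1 i hi
    -- the polynomial of degree at most `e` that vanishes at the other parameters in `I`
    let p : Polynomial ℝ := ∏ j ∈ I.erase i, (Polynomial.X - Polynomial.C (j.val : ℝ))
    have hp : p.natDegree ≤ e := by
      rw [Polynomial.natDegree_prod_of_monic _ _ fun j _ => Polynomial.monic_X_sub_C _]
      simp only [Polynomial.natDegree_X_sub_C, Finset.sum_const, smul_eq_mul, mul_one]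
      rw [Finset.card_erase_of_mem i.2, hI]
      simp
    have hs : ∑ j ∈ s, w j * p.eval (j.1.val : ℝ) = 0 := by
      have h1 : ∀ j : Fin e, ∑ a ∈ s, w a * (a.1.val : ℝ) ^ (j.val + 1) = 0 := fun j => by
        have := congrFun hw1 j
        simpa [momentCurve] using this
      simp only [eval_eq_coeff_zero_add_sum p hp, mul_add, Finset.sum_add_distrib,
        ← Finset.sum_mul, hw0, Finset.mul_sum]
      rw [Finset.sum_comm, zero_mul, zero_add]
      refine Finset.sum_eq_zero fun j _ => ?_
      rw [← mul_zero (p.coeff (j.val + 1)), ← h1 j, Finset.mul_sum]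
      exact Finset.sum_congr rfl fun a _ => by ring
    have hother : ∀ j ∈ s, j ≠ i → w j * p.eval (j.1.val : ℝ) = 0 := fun j _ hj => by
      have : p.eval (j.1.val : ℝ) = 0 := by
        rw [Polynomial.eval_prod]
        exact Finset.prod_eq_zero (i := j.1)
          (Finset.mem_erase.2 ⟨fun h => hj (Subtype.ext h), j.2⟩) (by simp)
      rw [this, mul_zero]
    rw [Finset.sum_eq_single_of_mem i hi hother] at hs
    refine (mul_eq_zero.1 hs).resolve_right ?_
    rw [Polynomial.eval_prod]
    refine Finset.prod_ne_zero_iff.2 fun j hj => ?_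
    simp only [Polynomial.eval_sub, Polynomial.eval_X, Polynomial.eval_C]
    exact sub_ne_zero.2 fun h => (Finset.mem_erase.1 hj).1 (hinj h).symm
  · intro I hI
    rcases I.eq_empty_or_nonempty with rfl | ⟨i₀, hi₀⟩
    · exact ⟨∅, fun h => absurd h Set.not_nonempty_empty, by simp⟩
    let q : Polynomial ℝ := ∏ j ∈ I, (Polynomial.X - Polynomial.C (j.val : ℝ))
    let p : Polynomial ℝ := q ^ 2
    have hp : p.natDegree ≤ e := by
      rw [Polynomial.natDegree_pow,
        Polynomial.natDegree_prod_of_monic _ _ fun j _ => Polynomial.monic_X_sub_C _]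
      simp only [Polynomial.natDegree_X_sub_C, Finset.sum_const, smul_eq_mul, mul_one]
      omega
    have hq0 : ∀ i : Fin m, q.eval (i.val : ℝ) = 0 ↔ i ∈ I := fun i => by
      rw [Polynomial.eval_prod, Finset.prod_eq_zero_iff]
      simp only [Polynomial.eval_sub, Polynomial.eval_X, Polynomial.eval_C, sub_eq_zero]
      exact ⟨fun ⟨j, hj, h⟩ => hinj h ▸ hj, fun h => ⟨i, h, rfl⟩⟩
    let l : (Fin e → ℝ) →ₗ[ℝ] ℝ :=
      - ∑ j : Fin e, p.coeff (j.val + 1) • (LinearMap.proj j : (Fin e → ℝ) →ₗ[ℝ] ℝ)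
    have hl : ∀ i, l (momentCurve m e i) = p.coeff 0 - q.eval (i.val : ℝ) ^ 2 := fun i => by
      have h1 : q.eval (i.val : ℝ) ^ 2 = p.eval (i.val : ℝ) := by simp [p]
      rw [h1, eval_eq_coeff_zero_add_sum p hp]
      simp [l, momentCurve]
    have hle : ∀ x ∈ convexHull ℝ (Set.range (momentCurve m e)), l x ≤ p.coeff 0 := by
      intro x hx
      refine convexHull_min ?_ (convex_halfSpace_le l.isLinear (p.coeff 0)) hx
      rintro _ ⟨i, rfl⟩
      change l _ ≤ _
      rw [hl]
      nlinarith [sq_nonneg (q.eval (i.val : ℝ))]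
    have hmem : ∀ i, momentCurve m e i ∈ convexHull ℝ (Set.range (momentCurve m e)) := fun i =>
      subset_convexHull ℝ _ ⟨i, rfl⟩
    refine ⟨_, fun _ => ⟨LinearMap.toContinuousLinearMap l, rfl⟩, fun i => ?_⟩
    simp only [Set.mem_ofPred_eq, LinearMap.coe_toContinuousLinearMap', hmem i, true_and]
    constructor
    · intro h
      have := h _ (hmem i₀)
      rw [hl, hl, (hq0 i₀).2 hi₀] at this
      rw [← hq0]
      nlinarith [sq_nonneg (q.eval (i.val : ℝ))]
    · intro hi y hy
      rw [hl, (hq0 i).2 hi]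
      simpa using hle y hy

/-! ### The rows of the deformed cube -/

/-- The part of the left-hand side of the deformed cube below the diagonal, which is the same for
the rows `+i` and `-i`: the rows after the first one are those of the stacked matrix. -/
noncomputable def lowerMatrix {n d : ℕ} (g : Matrix (Fin (d - 1)) (Fin (n - d)) ℝ) :
    Matrix (Fin n) (Fin n) ℝ := fun i j =>
  if h : i.val ≠ 0 ∧ j.val < n - d then
    stackIdentity g ⟨i.val - 1, by omega⟩ ⟨j.val, h.2⟩ else 0

/-- The first `n - d` coordinates. -/
def firstCoords {n d : ℕ} (x : Fin n → ℝ) : Fin (n - d) → ℝ := fun j => x ⟨j.val, by omega⟩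

/-- The embedding of `ℝⁿ⁻ᵈ` as the kernel of the projection to the last `d` coordinates. -/
def extendZero (n d : ℕ) : (Fin (n - d) → ℝ) →ₗ[ℝ] (Fin n → ℝ) where
  toFun y j := if h : j.val < n - d then y ⟨j.val, h⟩ else 0
  map_add' y z := by ext j; simp only [Pi.add_apply]; split_ifs <;> simp
  map_smul' a y := by ext j; simp only [Pi.smul_apply, RingHom.id_apply]; split_ifs <;> simp

lemma extendZero_apply {n d : ℕ} (y : Fin (n - d) → ℝ) (j : Fin n) :
    extendZero n d y j = if h : j.val < n - d then y ⟨j.val, h⟩ else 0 := rfl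

lemma firstCoords_extendZero {n d : ℕ} (y : Fin (n - d) → ℝ) :
    firstCoords (extendZero n d y) = y := by
  ext j
  simp [firstCoords, extendZero_apply]

lemma abs_extendZero_le {n d : ℕ} (y : Fin (n - d) → ℝ) (j : Fin n) :
    |extendZero n d y j| ≤ ‖y‖ := by
  rw [extendZero_apply]
  split_ifs with h
  · exact norm_le_pi_norm y _
  · simp

lemma lowerMatrix_eq_zero {n d : ℕ} (g : Matrix (Fin (d - 1)) (Fin (n - d)) ℝ) {i j : Fin n}
    (h : i ≤ j) : lowerMatrix g i j = 0 := by
  have h' : i.val ≤ j.val := h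
  unfold lowerMatrix stackIdentity
  split_ifs with h1 h2 h3
  · simp only at h2; omega
  · simp only at h3; omega
  · rfl
  · rfl

lemma deformedLhs_eq {n d : ℕ} (ε : ℝ) (g : Matrix (Fin (d - 1)) (Fin (n - d)) ℝ)
    (r : Fin n × Bool) (j : Fin n) :
    deformedLhs ε g r j = lowerMatrix g r.1 j + if j = r.1 then (if r.2 then ε else -ε) else 0 := by
  by_cases hj : j = r.1
  · rw [lowerMatrix_eq_zero g hj.ge]
    simp [deformedLhs, hj]
  · have hj' : j.val ≠ r.1.val := fun h => hj (Fin.ext h)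
    simp only [deformedLhs, lowerMatrix, stackIdentity, if_neg hj, add_zero]
    by_cases h1 : n - d < r.1.val ∧ j.val < n - d
    · rw [dif_pos h1, dif_pos ⟨by omega, h1.2⟩, dif_pos (by omega)]
      congr 2
      omega
    · rw [dif_neg h1]
      by_cases h2 : r.1.val ≠ 0 ∧ j.val < n - d
      · rw [dif_pos h2, dif_neg (by omega)]
        refine if_congr ?_ rfl rfl
        omega
      · rw [dif_neg h2, if_neg (by omega)]

lemma deformedLhs_mulVec {n d : ℕ} (ε : ℝ) (g : Matrix (Fin (d - 1)) (Fin (n - d)) ℝ)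
    (x : Fin n → ℝ) (r : Fin n × Bool) :
    (deformedLhs ε g).mulVec x r =
      (lowerMatrix g).mulVec x r.1 + (if r.2 then ε else -ε) * x r.1 := by
  simp [Matrix.mulVec, dotProduct, deformedLhs_eq, add_mul, Finset.sum_add_distrib]

lemma lowerMatrix_mulVec_eq_zero {n d : ℕ} (g : Matrix (Fin (d - 1)) (Fin (n - d)) ℝ)
    {x : Fin n → ℝ} {i : Fin n} (h : ∀ j < i, x j = 0) : (lowerMatrix g).mulVec x i = 0 := by
  rw [Matrix.mulVec, dotProduct]
  refine Finset.sum_eq_zero fun j _ => ?_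
  rcases lt_or_ge j i with hj | hj
  · rw [h j hj, mul_zero]
  · rw [lowerMatrix_eq_zero g hj, zero_mul]

lemma lowerMatrix_mulVec {n d : ℕ} (g : Matrix (Fin (d - 1)) (Fin (n - d)) ℝ)
    (x : Fin n → ℝ) {i : Fin n} (hi : i.val ≠ 0) :
    (lowerMatrix g).mulVec x i =
      (stackIdentity g).mulVec (firstCoords x) ⟨i.val - 1, by omega⟩ := by
  simp only [Matrix.mulVec, dotProduct]
  symm
  refine Finset.sum_of_injOn (fun j : Fin (n - d) => (⟨j.val, by omega⟩ : Fin n)) ?_ ?_ ?_ ?_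
  · intro a _ b _ h
    exact Fin.ext (Fin.mk.inj_iff.1 h)
  · exact fun _ _ => Finset.mem_coe.2 (Finset.mem_univ _)
  · intro j _ hj
    have : ¬ j.val < n - d := fun h => hj ⟨⟨j.val, h⟩, by simp, rfl⟩
    simp [lowerMatrix, this]
  · intro j _
    simp [lowerMatrix, hi, firstCoords]

/-- The projection to the last `d` coordinates as a linear map. -/
def lastCoordsLinear {n d : ℕ} (h : d ≤ n) : (Fin n → ℝ) →ₗ[ℝ] (Fin d → ℝ) :=
  LinearMap.funLeft ℝ ℝ fun j : Fin d => (⟨n - d + j.val, by omega⟩ : Fin n)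

lemma coe_lastCoordsLinear {n d : ℕ} (h : d ≤ n) : ⇑(lastCoordsLinear h) = lastCoords h := rfl

lemma lastCoords_extendZero {n d : ℕ} (h : d ≤ n) (y : Fin (n - d) → ℝ) :
    lastCoords h (extendZero n d y) = 0 := by
  ext j
  simp [lastCoords, extendZero_apply]

lemma eq_extendZero_of_lastCoords {n d : ℕ} (h : d ≤ n) {x : Fin n → ℝ}
    (hx : lastCoords h x = 0) : x = extendZero n d (firstCoords x) := by
  ext j
  rw [extendZero_apply]
  split_ifs with hj
  · rfl
  · have := congrFun hx ⟨j.val - (n - d), by omega⟩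
    simp only [lastCoords, Pi.zero_apply] at this
    rw [← this]
    congr 1
    ext
    change j.val = n - d + (j.val - (n - d))
    omega

lemma lastCoordsLinear_surjective {n d : ℕ} (h : d ≤ n) :
    Function.Surjective (lastCoordsLinear h) :=
  LinearMap.funLeft_surjective_of_injective _ _ _ fun i j hij => by
    have := Fin.mk.inj_iff.1 hij
    exact Fin.ext (by omega)

/-! ### The deformed cube as a system of inequalities -/

/-- The slack functions of the deformed cube. -/
noncomputable def deformedSystem {n d : ℕ} (ε : ℝ) (g : Matrix (Fin (d - 1)) (Fin (n - d)) ℝ)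
    (b : Fin n × Bool → ℝ) (r : Fin n × Bool) : (Fin n → ℝ) →ᵃ[ℝ] ℝ :=
  AffineMap.const ℝ _ (b r) - (LinearMap.proj r ∘ₗ (deformedLhs ε g).mulVecLin).toAffineMap

lemma deformedSystem_apply {n d : ℕ} (ε : ℝ) (g : Matrix (Fin (d - 1)) (Fin (n - d)) ℝ)
    (b : Fin n × Bool → ℝ) (r : Fin n × Bool) (x : Fin n → ℝ) :
    deformedSystem ε g b r x = b r - (deformedLhs ε g).mulVec x r := by
  simp [deformedSystem]

lemma deformedCube_eq_tightFace {n d : ℕ} (ε : ℝ) (g : Matrix (Fin (d - 1)) (Fin (n - d)) ℝ)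
    (b : Fin n × Bool → ℝ) : deformedCube ε g b = tightFace (deformedSystem ε g b) ∅ := by
  ext x
  simp [deformedCube, tightFace, deformedSystem_apply]

lemma isSuitableRhs_iff {n d : ℕ} (ε : ℝ) (g : Matrix (Fin (d - 1)) (Fin (n - d)) ℝ)
    (b : Fin n × Bool → ℝ) : IsSuitableRhs ε g b ↔ IsCubeSystem (deformedSystem ε g b) := by
  refine forall_congr' fun S => iff_congr (exists_congr fun x => and_congr ?_ ?_) Iff.rfl
  · simp [deformedCube, deformedSystem_apply]
  · simp only [zeroSet, deformedSystem_apply, sub_eq_zero, eq_comm]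

lemma abs_lowerMatrix_mulVec_le {n d : ℕ} (g : Matrix (Fin (d - 1)) (Fin (n - d)) ℝ)
    {x M : Fin n → ℝ} {i : Fin n} (h : ∀ j < i, |x j| ≤ M j) :
    |(lowerMatrix g).mulVec x i| ≤ ∑ j, |lowerMatrix g i j| * M j := by
  rw [Matrix.mulVec, dotProduct]
  refine (Finset.abs_sum_le_sum_abs _ _).trans (Finset.sum_le_sum fun j _ => ?_)
  rw [abs_mul]
  rcases lt_or_ge j i with hj | hj
  · exact mul_le_mul_of_nonneg_left (h j hj) (abs_nonneg _)
  · simp [lowerMatrix_eq_zero g hj]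

lemma exists_bound_deformedCube {n d : ℕ} {ε : ℝ} (hε : 0 < ε)
    (g : Matrix (Fin (d - 1)) (Fin (n - d)) ℝ) (b : Fin n × Bool → ℝ) (i : Fin n) :
    ∃ M, ∀ x ∈ deformedCube ε g b, |x i| ≤ M := by
  induction i using WellFoundedLT.induction with
  | ind i ih =>
    have h : ∀ j, ∃ M, j < i → ∀ x ∈ deformedCube ε g b, |x j| ≤ M := fun j => by
      by_cases hj : j < i
      · obtain ⟨M, hM⟩ := ih j hj
        exact ⟨M, fun _ => hM⟩
      · exact ⟨0, fun h => absurd h hj⟩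
    choose M hM using h
    refine ⟨(|b (i, true)| + |b (i, false)| + ∑ j, |lowerMatrix g i j| * M j) / ε,
      fun x hx => ?_⟩
    have h1 := hx (i, true)
    have h2 := hx (i, false)
    rw [deformedLhs_mulVec] at h1 h2
    simp only [if_true, Bool.false_eq_true, if_false] at h1 h2
    have h3 := abs_le.1 (abs_lowerMatrix_mulVec_le g (x := x) (M := M) (i := i)
      fun j hj => hM j hj x hx)
    rw [le_div_iff₀ hε, show |x i| * ε = |ε * x i| by rw [abs_mul, abs_of_pos hε, mul_comm],
      abs_le]
    have := le_abs_self (b (i, true))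
    have := le_abs_self (b (i, false))
    have := abs_nonneg (b (i, true))
    have := abs_nonneg (b (i, false))
    constructor <;> linarith

lemma isCompact_deformedCube {n d : ℕ} {ε : ℝ} (hε : 0 < ε)
    (g : Matrix (Fin (d - 1)) (Fin (n - d)) ℝ) (b : Fin n × Bool → ℝ) :
    IsCompact (deformedCube ε g b) := by
  choose M hM using exists_bound_deformedCube hε g b
  refine (isCompact_Icc (a := -M) (b := M)).of_isClosed_subset ?_ fun x hx =>
    ⟨fun i => (abs_le.1 (hM i x hx)).1, fun i => (abs_le.1 (hM i x hx)).2⟩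
  have : deformedCube ε g b = ⋂ r, {x | (deformedLhs ε g).mulVec x r ≤ b r} := by
    ext x; simp [deformedCube]
  rw [this]
  exact isClosed_iInter fun r => isClosed_le
    ((continuous_apply r).comp (Continuous.matrix_mulVec continuous_const continuous_id))
    continuous_const

/-- The system is triangular, so it can be solved row by row. For `s i = 1`, `-1`, `0` the solution
is at the upper end, the lower end, and the middle of the range allowed by the rows `± i`. -/
lemma exists_mulVec_lowerMatrix_eq {n d : ℕ} {ε : ℝ} (hε : 0 < ε)
    (g : Matrix (Fin (d - 1)) (Fin (n - d)) ℝ) (B : Fin n → ℝ) (s : Fin n → ℝ) :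
    ∃ x : Fin n → ℝ, ∀ i, ε * x i = s i * (B i - (lowerMatrix g).mulVec x i) := by
  suffices h : ∀ k : ℕ, ∃ x : Fin n → ℝ, ∀ i : Fin n, i.val < k →
      ε * x i = s i * (B i - (lowerMatrix g).mulVec x i) by
    obtain ⟨x, hx⟩ := h n
    exact ⟨x, fun i => hx i i.2⟩
  intro k
  induction k with
  | zero => exact ⟨0, fun i hi => absurd hi (Nat.not_lt_zero _)⟩
  | succ k ih =>
    obtain ⟨x, hx⟩ := ih
    by_cases hk : k < n
    swap
    · exact ⟨x, fun i _ => hx i (by omega)⟩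
    set p : Fin n := ⟨k, hk⟩
    set a := s p * (B p - (lowerMatrix g).mulVec x p) / ε with ha
    have hlow : ∀ i ≤ p, (lowerMatrix g).mulVec (Function.update x p a) i =
        (lowerMatrix g).mulVec x i := by
      intro i hi
      rw [← sub_eq_zero, ← Pi.sub_apply, ← Matrix.mulVec_sub]
      refine lowerMatrix_mulVec_eq_zero g fun j hj => ?_
      rw [Pi.sub_apply, Function.update_of_ne (hj.trans_le hi).ne, sub_self]
    refine ⟨Function.update x p a, fun i hi => ?_⟩
    rcases (Nat.lt_succ_iff.1 hi).eq_or_lt with h | h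
    · have : i = p := Fin.ext h
      subst this
      rw [hlow _ le_rfl, Function.update_self, ha, mul_div_cancel₀ _ hε.ne']
    · rw [hlow i (Fin.le_def.2 h.le), Function.update_of_ne (fun h' => by
        rw [h'] at h; exact lt_irrefl _ h)]
      exact hx i h

/-- Suitable right-hand sides exist: if the right-hand sides grow fast enough, then in every row the
part below the diagonal is dominated, so that for all admissible values of the earlier coordinates
the next coordinate ranges over an interval of positive length. -/
theorem exists_isSuitableRhs {n d : ℕ} {ε : ℝ} (hε : 0 < ε)
    (g : Matrix (Fin (d - 1)) (Fin (n - d)) ℝ) : ∃ b, IsSuitableRhs ε g b := by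
  classical
  obtain ⟨a, ha⟩ : ∃ a : ℝ, ∀ i j, |lowerMatrix g i j| ≤ a := by
    obtain ⟨a, ha⟩ := (Set.finite_range fun p : Fin n × Fin n => |lowerMatrix g p.1 p.2|).bddAbove
    exact ⟨a, fun i j => ha ⟨(i, j), rfl⟩⟩
  set B : ℝ := 2 * |a| / ε + 1 with hB
  have hB0 : 0 < B := by positivity
  have hdom : ∀ (x : Fin n → ℝ) (i : Fin n), (∀ j < i, ε * |x j| ≤ 2 * B ^ j.val) →
      |(lowerMatrix g).mulVec x i| < B ^ i.val := by
    intro x i hx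
    have h1 := abs_lowerMatrix_mulVec_le g (x := x) (M := fun j => 2 * B ^ j.val / ε) (i := i)
      fun j hj => by rw [le_div_iff₀ hε, mul_comm]; exact hx j hj
    have h2 : ∑ j, |lowerMatrix g i j| * (2 * B ^ j.val / ε) ≤
        ∑ j : Fin n, if j.val < i.val then (B - 1) * B ^ j.val else 0 := by
      refine Finset.sum_le_sum fun j _ => ?_
      split_ifs with hj
      · have : (B - 1) * B ^ j.val = |a| * (2 * B ^ j.val / ε) := by rw [hB]; ring
        rw [this]
        exact mul_le_mul_of_nonneg_right ((ha i j).trans (le_abs_self a)) (by positivity)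
      · rw [lowerMatrix_eq_zero g (not_lt.1 hj)]; simp
    have h3 : (∑ j : Fin n, if j.val < i.val then (B - 1) * B ^ j.val else 0) = B ^ i.val - 1 := by
      rw [← Finset.sum_range fun j => if j < i.val then (B - 1) * B ^ j else 0,
        ← Finset.sum_filter, show (Finset.range n).filter (fun j => j < i.val) =
          Finset.range i.val by ext j; simp; omega, ← Finset.mul_sum, mul_geom_sum]
    linarith
  refine ⟨fun r => B ^ r.1.val, fun S => ⟨?_, fun hS => ?_⟩⟩
  · rintro ⟨x, hx, rfl⟩ i ⟨h1, h2⟩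
    have hrow : ∀ j, (lowerMatrix g).mulVec x j + ε * x j ≤ B ^ j.val ∧
        (lowerMatrix g).mulVec x j + -ε * x j ≤ B ^ j.val := fun j => by
      have h1 := hx (j, true)
      have h2 := hx (j, false)
      rw [deformedLhs_mulVec] at h1 h2
      simpa using And.intro h1 h2
    have hbd : ∀ j, |(lowerMatrix g).mulVec x j| < B ^ j.val := fun j => by
      induction j using WellFoundedLT.induction with
      | ind j ih =>
        refine hdom x j fun k hk => ?_
        have h1 := abs_lt.1 (ih k hk)
        have h2 := hrow k
        rw [show ε * |x k| = |ε * x k| by rw [abs_mul, abs_of_pos hε], abs_le]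
        constructor <;> linarith
    simp only [Set.mem_ofPred_eq, deformedLhs_mulVec, if_true, Bool.false_eq_true,
      if_false] at h1 h2
    have h3 := abs_lt.1 (hbd i)
    linarith
  · let s : Fin n → ℝ := fun i => if (i, true) ∈ S then 1 else if (i, false) ∈ S then -1 else 0
    have hs : ∀ i, s i = if (i, true) ∈ S then 1 else if (i, false) ∈ S then -1 else 0 :=
      fun _ => rfl
    obtain ⟨x, hx⟩ := exists_mulVec_lowerMatrix_eq hε g (fun i => B ^ i.val) s
    have hs1 : ∀ i, |s i| ≤ 1 := fun i => by rw [hs]; split_ifs <;> simp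
    have hbd : ∀ j, |(lowerMatrix g).mulVec x j| < B ^ j.val := fun j => by
      induction j using WellFoundedLT.induction with
      | ind j ih =>
        refine hdom x j fun k hk => ?_
        have h1 := abs_lt.1 (ih k hk)
        rw [show ε * |x k| = |ε * x k| by rw [abs_mul, abs_of_pos hε], hx k, abs_mul,
          abs_of_pos (by linarith : 0 < B ^ k.val - (lowerMatrix g).mulVec x k)]
        exact (mul_le_of_le_one_left (by linarith) (hs1 k)).trans (by linarith)
    have hval : ∀ i β, (deformedLhs ε g).mulVec x (i, β) = (lowerMatrix g).mulVec x i +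
        (if β then 1 else -1) * (s i * (B ^ i.val - (lowerMatrix g).mulVec x i)) := by
      intro i β
      rw [deformedLhs_mulVec, ← hx]
      cases β <;> simp
    refine ⟨x, ?_, ?_⟩
    · rintro ⟨i, β⟩
      rw [hval, hs]
      have h1 := abs_lt.1 (hbd i)
      change _ ≤ B ^ i.val
      cases β <;> split_ifs <;> linarith
    · ext ⟨i, β⟩
      simp only [Set.mem_ofPred_eq]
      rw [hval, hs]
      have h1 := abs_lt.1 (hbd i)
      have hSi := hS i
      cases β
      · by_cases h2 : (i, true) ∈ S
        · have h3 : (i, false) ∉ S := fun h => hSi ⟨h2, h⟩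
          simp only [h2, h3, if_true, Bool.false_eq_true, if_false, iff_false]
          intro h; linarith
        · by_cases h3 : (i, false) ∈ S
          · simp [h2, h3]
          · simp only [h2, h3, Bool.false_eq_true, if_false, iff_false]
            intro h; linarith
      · by_cases h2 : (i, true) ∈ S
        · simp [h2]
        · by_cases h3 : (i, false) ∈ S
          · simp only [h2, h3, if_true, if_false, iff_false]
            intro h; linarith
          · simp only [h2, h3, if_true, if_false, iff_false]
            intro h; linarith

/-! ### Position of the normals with respect to the projection -/

/-- Any signed set of at least `n - d` rows of the deformed cube spans the dual of the kernel of the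
projection: the rows have no common zero on this kernel but the origin. -/
def RowsSpan {n d : ℕ} (ε : ℝ) (g : Matrix (Fin (d - 1)) (Fin (n - d)) ℝ) : Prop :=
  ∀ S : Set (Fin n × Bool), IsSignedSet S → n - d ≤ S.ncard → ∀ y : Fin (n - d) → ℝ,
    (∀ r ∈ S, (deformedLhs ε g).mulVec (extendZero n d y) r = 0) → y = 0

/-- The rows that are tight on a face of dimension at most `⌊d/2⌋ - 1` positively span the dual of
the kernel of the projection. This is stated dually: they are jointly nonnegative on this kernel
only at the origin. -/
def RowsSpanPositively {n d : ℕ} (ε : ℝ) (g : Matrix (Fin (d - 1)) (Fin (n - d)) ℝ) : Prop :=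
  ∀ S : Set (Fin n × Bool), n ≤ S.ncard + (d / 2 - 1) → IsSignedSet S →
    ∀ y : Fin (n - d) → ℝ,
      (∀ r ∈ S, 0 ≤ (deformedLhs ε g).mulVec (extendZero n d y) r) → y = 0

/-- The functional on the kernel of the projection given by row `i` below the diagonal. -/
noncomputable def lowerRow {n d : ℕ} (g : Matrix (Fin (d - 1)) (Fin (n - d)) ℝ) (i : Fin n) :
    (Fin (n - d) → ℝ) →ₗ[ℝ] ℝ :=
  LinearMap.proj i ∘ₗ (lowerMatrix g).mulVecLin ∘ₗ extendZero n d

lemma lowerRow_apply {n d : ℕ} (g : Matrix (Fin (d - 1)) (Fin (n - d)) ℝ) (i : Fin n)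
    (y : Fin (n - d) → ℝ) : lowerRow g i y = (lowerMatrix g).mulVec (extendZero n d y) i := rfl

lemma lowerRow_eq {n d : ℕ} (g : Matrix (Fin (d - 1)) (Fin (n - d)) ℝ) {i : Fin n}
    (hi : i.val ≠ 0) (y : Fin (n - d) → ℝ) :
    lowerRow g i y = (stackIdentity g).mulVec y ⟨i.val - 1, by omega⟩ := by
  rw [lowerRow_apply, lowerMatrix_mulVec g _ hi, firstCoords_extendZero]

/-- The index of the rows of the deformed cube in which the Gale vector of a given point of the
configuration stands; the first index is skipped. -/
def rowOfPoint {n : ℕ} : Fin (n - 1) ↪ Fin n where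
  toFun t := ⟨t.val + 1, by omega⟩
  inj' s t h := Fin.ext (by have := Fin.mk.inj_iff.1 h; omega)

lemma lowerRow_rowOfPoint {n d : ℕ} (g : Matrix (Fin (d - 1)) (Fin (n - d)) ℝ) (t : Fin (n - 1))
    (y : Fin (n - d) → ℝ) : lowerRow g (rowOfPoint t) y = (stackIdentity g).mulVec y t :=
  lowerRow_eq g (Nat.succ_ne_zero _) y

lemma exists_rowOfPoint {n : ℕ} {i : Fin n} (hi : i.val ≠ 0) : ∃ t, rowOfPoint t = i :=
  ⟨⟨i.val - 1, by omega⟩, Fin.ext (by change i.val - 1 + 1 = i.val; omega)⟩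

/-- As any `n - d` rows of the Gale transform span, this holds with a margin, which exceeds every
small `ε`. -/
lemma eventually_lowerRow_large {n d : ℕ} (hd : 2 ≤ d) (hdn : d ≤ n)
    {v : Fin (n - 1) → Fin (d - 2) → ℝ} (hv : IsNeighborlyGeneral v)
    {g : Matrix (Fin (d - 1)) (Fin (n - d)) ℝ} (hG : IsGaleTransform v (stackIdentity g)) :
    ∀ᶠ ε in nhdsWithin (0 : ℝ) (Set.Ioi 0), ∀ D : Finset (Fin n), (∀ i ∈ D, i.val ≠ 0) →
      n - d ≤ D.card → ∀ y, y ≠ 0 → ∃ i ∈ D, ε * ‖y‖ < |lowerRow g i y| := by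
  rw [Filter.eventually_all]
  intro D
  by_cases hD : (∀ i ∈ D, i.val ≠ 0) ∧ n - d ≤ D.card
  swap
  · exact Filter.Eventually.of_forall fun ε h1 h2 => absurd ⟨h1, h2⟩ hD
  obtain ⟨c, hc, hm⟩ := exists_margin_abs (fun i : D => lowerRow g i) fun y hy => by
    refine hG.eq_zero_of_rows hv (by omega) (T := D.preimage rowOfPoint rowOfPoint.injective.injOn)
      ?_ fun t ht => ?_
    · rw [Finset.card_preimage, Finset.filter_true_of_mem fun i hi =>
        Set.mem_range.2 (exists_rowOfPoint (hD.1 i hi))]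
      exact hD.2
    · rw [← lowerRow_rowOfPoint]
      exact hy ⟨_, Finset.mem_preimage.1 ht⟩
  filter_upwards [Ioo_mem_nhdsGT hc] with ε hε _ _ y hy
  obtain ⟨i, hi⟩ := hm y hy
  exact ⟨i, i.2, (mul_le_mul_of_nonneg_right hε.2.le (norm_nonneg y)).trans_lt hi⟩

/-- As the rows of the Gale transform outside a small index set span positively, this holds with a
margin, which exceeds every small `ε`. -/
lemma eventually_lowerRow_neg {n d : ℕ} (hd : 2 ≤ d) (hdn : d ≤ n)
    {v : Fin (n - 1) → Fin (d - 2) → ℝ} (hv : IsNeighborlyGeneral v)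
    {g : Matrix (Fin (d - 1)) (Fin (n - d)) ℝ} (hG : IsGaleTransform v (stackIdentity g)) :
    ∀ᶠ ε in nhdsWithin (0 : ℝ) (Set.Ioi 0), ∀ D : Finset (Fin n), n ≤ D.card + (d / 2 - 1) →
      ∀ y, y ≠ 0 → ∃ i ∈ D, ε * ‖y‖ < - lowerRow g i y := by
  classical
  rw [Filter.eventually_all]
  intro D
  by_cases hD : n ≤ D.card + (d / 2 - 1)
  swap
  · exact Filter.Eventually.of_forall fun ε h => absurd h hD
  obtain ⟨c, hc, hm⟩ := exists_margin (fun i : D => - lowerRow g i) fun y hy => by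
    by_contra! hcon
    refine hy (hG.eq_zero_of_nonneg hv (by omega)
      (I := Dᶜ.preimage rowOfPoint rowOfPoint.injective.injOn) ?_ fun t ht => ?_)
    · have h1 : (Dᶜ.preimage rowOfPoint rowOfPoint.injective.injOn).card ≤ Dᶜ.card := by
        rw [Finset.card_preimage]
        exact Finset.card_filter_le _ _
      rw [Finset.card_compl, Fintype.card_fin] at h1
      omega
    · rw [← lowerRow_rowOfPoint]
      have ht' : rowOfPoint t ∈ D := by simpa using ht
      simpa using hcon ⟨_, ht'⟩
  filter_upwards [Ioo_mem_nhdsGT hc] with ε hε _ y hy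
  obtain ⟨i, hi⟩ := hm y hy
  exact ⟨i, i.2, (mul_le_mul_of_nonneg_right hε.2.le (norm_nonneg y)).trans_lt hi⟩

lemma IsSignedSet.exists_index_finset {n : ℕ} {S : Set (Fin n × Bool)} (hS : IsSignedSet S) :
    ∃ D : Finset (Fin n), D.card = S.ncard ∧ ∀ i, i ∈ D ↔ ∃ β, (i, β) ∈ S := by
  classical
  refine ⟨(Set.toFinite (Prod.fst '' S)).toFinset, ?_, fun i => ?_⟩
  · rw [← Set.ncard_eq_toFinset_card, hS.injOn_fst.ncard_image]
  · simp

lemma abs_mul_extendZero_le {n d : ℕ} {ε : ℝ} (hε : 0 < ε) (y : Fin (n - d) → ℝ) (i : Fin n)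
    (β : Bool) : |(if β then ε else -ε) * extendZero n d y i| ≤ ε * ‖y‖ := by
  have h : |if β then ε else -ε| = ε := by cases β <;> simp [abs_of_pos hε]
  rw [abs_mul, h]
  exact mul_le_mul_of_nonneg_left (abs_extendZero_le y i) hε.le

/-- The rows after the first pair are perturbed rows of the Gale transform. If a row of the
first pair is present, it is a multiple of the first unit vector on the kernel of the projection,
so that on the common zeros of the rows all coordinates before the first gap in the signed set
vanish. Then the row of the Gale transform that belongs to the gap vanishes there as well and
replaces the row of the first pair. -/
theorem rowsSpan_of_lowerRow_large {n d : ℕ} (hd : 2 ≤ d) (hdn : d ≤ n) {ε : ℝ} (hε : 0 < ε)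
    {g : Matrix (Fin (d - 1)) (Fin (n - d)) ℝ}
    (h : ∀ D : Finset (Fin n), (∀ i ∈ D, i.val ≠ 0) → n - d ≤ D.card → ∀ y, y ≠ 0 →
      ∃ i ∈ D, ε * ‖y‖ < |lowerRow g i y|) : RowsSpan ε g := by
  classical
  intro S hS hcard y hy
  by_contra hne
  obtain ⟨D, hDc, hD⟩ := hS.exists_index_finset
  have hsmall : ∀ i ∈ D, |lowerRow g i y| ≤ ε * ‖y‖ := by
    intro i hi
    obtain ⟨β, hβ⟩ := (hD i).1 hi
    have h1 := hy _ hβ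
    rw [deformedLhs_mulVec] at h1
    rw [lowerRow_apply, eq_neg_of_add_eq_zero_left h1, abs_neg]
    exact abs_mul_extendZero_le hε y i β
  -- in the rows before the first gap all coordinates vanish
  have hzero : ∀ i, (∀ j ≤ i, j ∈ D) → extendZero n d y i = 0 := by
    intro i
    induction i using WellFoundedLT.induction with
    | ind i ih =>
      intro hi
      obtain ⟨β, hβ⟩ := (hD i).1 (hi i le_rfl)
      have h1 := hy _ hβ
      rw [deformedLhs_mulVec, lowerMatrix_mulVec_eq_zero g fun j hj =>
        ih j hj fun k hk => hi k (hk.trans hj.le), zero_add] at h1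
      refine (mul_eq_zero.1 h1).resolve_left ?_
      cases β <;> simp [hε.ne']
  suffices hD' : ∃ D' : Finset (Fin n), (∀ i ∈ D', i.val ≠ 0) ∧ n - d ≤ D'.card ∧
      ∀ i ∈ D', |lowerRow g i y| ≤ ε * ‖y‖ by
    obtain ⟨D', h0, hc, hs⟩ := hD'
    obtain ⟨i, hi, hlt⟩ := h D' h0 hc y hne
    exact absurd (hs i hi) (not_le.2 hlt)
  set z : Fin n := ⟨0, by omega⟩ with hz
  by_cases h0 : z ∈ D
  swap
  · exact ⟨D, fun i hi h => h0 ((Fin.ext h : i = z) ▸ hi), hDc ▸ hcard, hsmall⟩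
  rcases Finset.eq_empty_or_nonempty Dᶜ with hfull | hgap
  · exfalso
    refine hne ?_
    rw [← firstCoords_extendZero (n := n) (d := d) y]
    ext j
    refine hzero _ fun k _ => ?_
    rw [Finset.compl_eq_empty_iff] at hfull
    rw [hfull]
    exact Finset.mem_univ k
  · set k := Dᶜ.min' hgap with hk
    have hkD : k ∉ D := Finset.mem_compl.1 (Finset.min'_mem _ hgap)
    have hlt : ∀ j < k, j ∈ D := fun j hj => by
      by_contra hjD
      exact absurd (Finset.min'_le Dᶜ j (Finset.mem_compl.2 hjD)) (not_le.2 hj)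
    refine ⟨(insert k D).erase z, fun i hi h => (Finset.mem_erase.1 hi).1 (Fin.ext h), ?_, ?_⟩
    · rw [Finset.card_erase_of_mem (Finset.mem_insert_of_mem h0), Finset.card_insert_of_notMem hkD]
      omega
    · intro i hi
      rcases Finset.mem_insert.1 (Finset.mem_of_mem_erase hi) with rfl | hi
      · rw [lowerRow_apply, lowerMatrix_mulVec_eq_zero g fun j hj =>
          hzero j fun l hl => hlt l (hl.trans_lt hj), abs_zero]
        positivity
      · exact hsmall i hi

theorem rowsSpanPositively_of_lowerRow_neg {n d : ℕ} {ε : ℝ} (hε : 0 < ε)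
    {g : Matrix (Fin (d - 1)) (Fin (n - d)) ℝ}
    (h : ∀ D : Finset (Fin n), n ≤ D.card + (d / 2 - 1) →
      ∀ y, y ≠ 0 → ∃ i ∈ D, ε * ‖y‖ < - lowerRow g i y) : RowsSpanPositively ε g := by
  intro S hcard hS y hy
  by_contra hne
  obtain ⟨D, hDc, hD⟩ := hS.exists_index_finset
  obtain ⟨i, hi, hlt⟩ := h D (hDc ▸ hcard) y hne
  obtain ⟨β, hβ⟩ := (hD i).1 hi
  have h1 := hy _ hβ
  rw [deformedLhs_mulVec, ← lowerRow_apply] at h1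
  have h2 := (abs_le.1 (abs_mul_extendZero_le hε y i β)).2
  simp only at h1
  linarith

theorem exists_forall_rowsSpan {n d : ℕ} (hd : 2 ≤ d) (hdn : d ≤ n)
    {v : Fin (n - 1) → Fin (d - 2) → ℝ} (hv : IsNeighborlyGeneral v)
    {g : Matrix (Fin (d - 1)) (Fin (n - d)) ℝ} (hG : IsGaleTransform v (stackIdentity g)) :
    ∃ ε₀ : ℝ, 0 < ε₀ ∧ ∀ ε, 0 < ε → ε < ε₀ → RowsSpan ε g ∧ RowsSpanPositively ε g := by
  have h := (eventually_lowerRow_large hd hdn hv hG).and (eventually_lowerRow_neg hd hdn hv hG)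
  obtain ⟨ε₀, h0, hsub⟩ := mem_nhdsGT_iff_exists_Ioo_subset.1 h
  refine ⟨ε₀, h0, fun ε h1 h2 => ?_⟩
  obtain ⟨h3, h4⟩ := hsub ⟨h1, h2⟩
  exact ⟨rowsSpan_of_lowerRow_large hd hdn h1 h3, rowsSpanPositively_of_lowerRow_neg h1 h4⟩

lemma RowsSpan.exists_eq {n d : ℕ} {ε : ℝ} {g : Matrix (Fin (d - 1)) (Fin (n - d)) ℝ}
    (h : RowsSpan ε g) {S : Set (Fin n × Bool)} (hS : IsSignedSet S) (hcard : S.ncard ≤ n - d)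
    (z : Fin n × Bool → ℝ) :
    ∃ y, ∀ r ∈ S, (deformedLhs ε g).mulVec (extendZero n d y) r = z r := by
  obtain ⟨T, hT, hST, hc⟩ := hS.exists_superset hcard (Nat.sub_le n d)
  have := Fintype.ofFinite T
  let L : (Fin (n - d) → ℝ) →ₗ[ℝ] (T → ℝ) :=
    LinearMap.funLeft ℝ ℝ Subtype.val ∘ₗ (deformedLhs ε g).mulVecLin ∘ₗ extendZero n d
  have hL : Function.Injective L := by
    rw [← LinearMap.ker_eq_bot, LinearMap.ker_eq_bot']
    exact fun y hy => h T hT hc.ge y fun r hr => congrFun hy ⟨r, hr⟩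
  obtain ⟨y, hy⟩ := (LinearMap.injective_iff_surjective_of_finrank_eq_finrank (by
    rw [Module.finrank_fin_fun, Module.finrank_fintype_fun_eq_card, ← Nat.card_eq_fintype_card,
      Nat.card_coe_set_eq, hc])).1 hL fun r => z r
  exact ⟨y, fun r hr => congrFun hy ⟨r, hST hr⟩⟩

/-! ### The faces of the projection -/

lemma linear_deformedSystem {n d : ℕ} (ε : ℝ) (g : Matrix (Fin (d - 1)) (Fin (n - d)) ℝ)
    (b : Fin n × Bool → ℝ) (r : Fin n × Bool) (x : Fin n → ℝ) :
    (deformedSystem ε g b r).linear x = - (deformedLhs ε g).mulVec x r := by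
  simp [deformedSystem]

/-- The projection is injective on every face in at least `n - d` facets. -/
lemma RowsSpan.injective_on_face {n d : ℕ} (hdn : d ≤ n) {ε : ℝ}
    {g : Matrix (Fin (d - 1)) (Fin (n - d)) ℝ} (h : RowsSpan ε g) (b : Fin n × Bool → ℝ)
    {S : Set (Fin n × Bool)} (hS : IsSignedSet S) (hcard : n - d ≤ S.ncard) :
    ∀ w ∈ vectorSpan ℝ (tightFace (deformedSystem ε g b) S), lastCoordsLinear hdn w = 0 →
      w = 0 := by
  intro w hw hπ
  have hw' := eq_extendZero_of_lastCoords hdn hπ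
  have hy : firstCoords w = 0 := h S hS hcard (firstCoords w) fun r hr => by
    have := vectorSpan_tightFace_le (deformedSystem ε g b) hr hw
    rw [LinearMap.mem_ker, linear_deformedSystem, neg_eq_zero] at this
    rwa [← hw']
  rw [hw', hy, map_zero]

/-- A nonempty face of the projection is the image of a face of the cube. If that face lies in
fewer than `n - d` facets, then the direction of the projection can be used to correct any
direction to one in the face, so the supporting functional is constant. -/
theorem exists_eq_image_tightFace {n d : ℕ} (hdn : d ≤ n) {ε : ℝ}
    {g : Matrix (Fin (d - 1)) (Fin (n - d)) ℝ} (h : RowsSpan ε g) {b : Fin n × Bool → ℝ}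
    (hb : IsCubeSystem (deformedSystem ε g b)) {F : Set (Fin d → ℝ)}
    (hF : IsExposed ℝ (lastCoordsLinear hdn '' tightFace (deformedSystem ε g b) ∅) F)
    (hne : F.Nonempty)
    (hprop : F ≠ lastCoordsLinear hdn '' tightFace (deformedSystem ε g b) ∅) :
    ∃ S, IsSignedSet S ∧ n - d ≤ S.ncard ∧
      F = lastCoordsLinear hdn '' tightFace (deformedSystem ε g b) S := by
  set π := lastCoordsLinear hdn
  set C := tightFace (deformedSystem ε g b) ∅ with hC
  obtain ⟨l, hl⟩ := hF hne
  set lπ : StrongDual ℝ (Fin n → ℝ) :=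
    LinearMap.toContinuousLinearMap ((l : (Fin d → ℝ) →ₗ[ℝ] ℝ) ∘ₗ π) with hlπ
  have hlπ' : ∀ x, lπ x = l (π x) := fun _ => rfl
  have himage : F = π '' {x ∈ C | ∀ y ∈ C, lπ y ≤ lπ x} := by
    rw [hl]
    exact (image_argmax π C l).symm
  obtain ⟨S, hS, -, hFS⟩ := exists_eq_tightFace_of_isExposed (f := deformedSystem ε g b)
    (S := ∅) (F := {x ∈ C | ∀ y ∈ C, lπ y ≤ lπ x}) (fun _ => ⟨lπ, rfl⟩)
    (Set.image_nonempty.1 (himage ▸ hne))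
  refine ⟨S, (hb S).1 hS, ?_, by rw [← hFS]; exact himage⟩
  by_contra! hlt
  refine hprop ?_
  have hS' := (hb S).1 hS
  obtain ⟨x, hx, rfl⟩ := hS
  have hxmax : ∀ y ∈ C, lπ y ≤ lπ x := by
    have : x ∈ tightFace (deformedSystem ε g b) (zeroSet (deformedSystem ε g b) x) :=
      ⟨hx, subset_rfl⟩
    rw [← hFS] at this
    exact this.2
  have hle : ∀ z, lπ z ≤ 0 := by
    intro z
    obtain ⟨y, hy⟩ := h.exists_eq hS' hlt.le fun r => - (deformedLhs ε g).mulVec z r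
    obtain ⟨t, ht, hfeas⟩ := exists_lineMap_feasible hx (z := x + (z + extendZero n d y))
      fun r hr => by
        have hr' : deformedSystem ε g b r x = 0 := hr
        rw [deformedSystem_apply] at hr' ⊢
        rw [Matrix.mulVec_add, Matrix.mulVec_add, Pi.add_apply, Pi.add_apply, hy r hr]
        linarith
    have h1 := hxmax _ ⟨hfeas, Set.empty_subset _⟩
    have h2 : lπ (extendZero n d y) = 0 := by
      rw [hlπ', show π (extendZero n d y) = 0 from lastCoords_extendZero hdn y, map_zero]
    rw [linear_lineMap_apply, map_add, map_add, h2] at h1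
    nlinarith
  have hzero : ∀ z, lπ z = 0 := fun z => le_antisymm (hle z) (by
    have := hle (-z)
    rw [map_neg] at this
    linarith)
  rw [himage]
  congr 1
  ext z
  simp [hzero]

/-- If the rows in `S` span positively, then a positive combination of them vanishes on the kernel
of the projection, hence comes from a functional on the image. It supports the image of the face
of `S`, and no other points of the cube project to it. -/
theorem exists_functional_of_rowsSpanPositively {n d : ℕ} (hdn : d ≤ n) {ε : ℝ}
    {g : Matrix (Fin (d - 1)) (Fin (n - d)) ℝ} (h : RowsSpanPositively ε g)
    {b : Fin n × Bool → ℝ} (hb : IsCubeSystem (deformedSystem ε g b))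
    {S : Set (Fin n × Bool)} (hS : IsSignedSet S) (hcard : n ≤ S.ncard + (d / 2 - 1)) :
    ∃ l : StrongDual ℝ (Fin d → ℝ), tightFace (deformedSystem ε g b) S =
      {x ∈ tightFace (deformedSystem ε g b) ∅ | ∀ y ∈ tightFace (deformedSystem ε g b) ∅,
        l (lastCoordsLinear hdn y) ≤ l (lastCoordsLinear hdn x)} := by
  have := Fintype.ofFinite S
  let row : S → (Fin n → ℝ) →ₗ[ℝ] ℝ := fun r =>
    LinearMap.proj r.1 ∘ₗ (deformedLhs ε g).mulVecLin
  have hrow : ∀ r x, row r x = (deformedLhs ε g).mulVec x r := fun _ _ => rfl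
  obtain ⟨c, hc, hsum⟩ := exists_pos_dependence (fun r => row r ∘ₗ extendZero n d) fun y hy j => by
    rw [h S hcard hS y fun r hr => hy ⟨r, hr⟩, map_zero]
  obtain ⟨σ, hσ⟩ := LinearMap.exists_rightInverse_of_surjective (lastCoordsLinear hdn)
    (LinearMap.range_eq_top.2 (lastCoordsLinear_surjective hdn))
  let L : (Fin n → ℝ) →ₗ[ℝ] ℝ := ∑ r, c r • row r
  have hL : ∀ x, L x = ∑ r, c r * row r x := fun x => by simp [L]
  have hLσ : ∀ x, L (σ (lastCoordsLinear hdn x)) = L x := by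
    intro x
    rw [← sub_eq_zero, ← map_sub]
    have hker : lastCoords hdn (σ (lastCoordsLinear hdn x) - x) = 0 := by
      rw [← coe_lastCoordsLinear, map_sub, sub_eq_zero]
      exact LinearMap.congr_fun hσ _
    rw [eq_extendZero_of_lastCoords hdn hker, hL]
    exact hsum _
  refine ⟨LinearMap.toContinuousLinearMap (L ∘ₗ σ), ?_⟩
  refine (tightFace_eq_argmax (Set.empty_subset S) ((hb S).2 hS).nonempty hc
    (l := LinearMap.toContinuousLinearMap L) fun x y => ?_).trans ?_
  · simp only [LinearMap.coe_toContinuousLinearMap', hL, ← Finset.sum_sub_distrib,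
      deformedSystem_apply, hrow]
    exact Finset.sum_congr rfl fun r _ => by ring
  · simp only [LinearMap.coe_toContinuousLinearMap', LinearMap.comp_apply, hLσ]

theorem isPolytopeOfDim_deformedCube {n d : ℕ} {ε : ℝ} (hε : 0 < ε)
    {g : Matrix (Fin (d - 1)) (Fin (n - d)) ℝ} {b : Fin n × Bool → ℝ}
    (hb : IsSuitableRhs ε g b) : IsPolytopeOfDim n (deformedCube ε g b) := by
  have hcube := (isSuitableRhs_iff ε g b).1 hb
  have hcomp := isCompact_deformedCube hε g b
  rw [deformedCube_eq_tightFace] at hcomp ⊢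
  refine ⟨exists_finset_convexHull_eq _ hcomp, ((hcube ∅).2 isSignedSet_empty).nonempty, ?_⟩
  simpa using affDim_tightFace_add_ncard hcube isSignedSet_empty

theorem combEquiv_deformedCube_stdCube {n d : ℕ} {ε : ℝ}
    {g : Matrix (Fin (d - 1)) (Fin (n - d)) ℝ} {b : Fin n × Bool → ℝ}
    (hb : IsSuitableRhs ε g b) : CombEquiv (deformedCube ε g b) (stdCube n) := by
  rw [deformedCube_eq_tightFace]
  exact combEquiv_tightFace_stdCube ((isSuitableRhs_iff ε g b).1 hb) isSignedSet_empty
    (Equiv.subtypeUnivEquiv fun _ _ => Set.notMem_empty _).symm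

lemma IsPolytopeOfDim.image_of_surjective {m k : ℕ} {P : Set (Fin m → ℝ)}
    (hP : IsPolytopeOfDim m P) {π : (Fin m → ℝ) →ₗ[ℝ] (Fin k → ℝ)}
    (hπ : Function.Surjective π) : IsPolytopeOfDim k (π '' P) := by
  classical
  obtain ⟨⟨s, hs⟩, hne, hdim⟩ := hP
  refine ⟨⟨s.image π, ?_⟩, hne.image _, ?_⟩
  · rw [hs, LinearMap.image_convexHull, Finset.coe_image]
  · have htop : vectorSpan ℝ P = ⊤ := Submodule.eq_top_of_finrank_eq (by
      rw [Module.finrank_fin_fun]; exact hdim)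
    have h : vectorSpan ℝ (π '' P) = (vectorSpan ℝ P).map π :=
      (AffineMap.map_vectorSpan π.toAffineMap (s := P)).symm
    rw [affDim, h, htop, Submodule.map_top, LinearMap.range_eq_top.2 hπ, finrank_top,
      Module.finrank_fin_fun]

theorem isNeighborlyCubical_image_deformedCube {n d : ℕ} (hd : 2 ≤ d) (hdn : d ≤ n) {ε : ℝ}
    (hε : 0 < ε) {g : Matrix (Fin (d - 1)) (Fin (n - d)) ℝ} (h₁ : RowsSpan ε g)
    (h₂ : RowsSpanPositively ε g) {b : Fin n × Bool → ℝ} (hb : IsSuitableRhs ε g b) :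
    IsNeighborlyCubical n d (lastCoords hdn '' deformedCube ε g b) := by
  have hcube := (isSuitableRhs_iff ε g b).1 hb
  have hpoly := (isPolytopeOfDim_deformedCube hε hb).image_of_surjective
    (lastCoordsLinear_surjective hdn)
  rw [← coe_lastCoordsLinear]
  rw [deformedCube_eq_tightFace] at hpoly ⊢
  refine ⟨hpoly, fun F hF hne hprop => ?_, ?_⟩
  · obtain ⟨S, hS, hcard, rfl⟩ := exists_eq_image_tightFace hdn h₁ hcube hF hne hprop
    obtain ⟨k, ⟨e⟩⟩ := exists_combEquiv_tightFace_stdCube hcube hS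
    obtain ⟨e'⟩ := combEquiv_image (lastCoordsLinear hdn) _ (h₁.injective_on_face hdn b hS hcard)
    exact ⟨k, ⟨e'.trans e⟩⟩
  · obtain ⟨e⟩ := nonempty_skeletonFaces_tightFace_orderIso (d / 2 - 1)
      (isCubeSystem_stdCubeSystem n)
    rw [← stdCube_eq_tightFace] at e
    have hdim : ∀ S, IsSignedSet S → n - d ≤ S.ncard →
        affDim (lastCoordsLinear hdn '' tightFace (deformedSystem ε g b) S) + S.ncard = n := by
      intro S hS hcard
      rw [affDim_image_of_injective _ _ (h₁.injective_on_face hdn b hS hcard)]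
      exact affDim_tightFace_add_ncard hcube hS
    obtain ⟨e'⟩ := nonempty_skeletonIndex_orderIso (n := n) (k := d / 2 - 1)
      (P := lastCoordsLinear hdn '' tightFace (deformedSystem ε g b) ∅)
      (fun S => lastCoordsLinear hdn '' tightFace (deformedSystem ε g b) S)
      (fun S hS hcard => by
        refine ⟨((hcube S).2 hS).nonempty.image _, fun _ => ?_, ?_⟩
        · obtain ⟨l, hl⟩ := exists_functional_of_rowsSpanPositively hdn h₂ hcube hS hcard
          exact ⟨l, by rw [hl]; exact image_argmax _ _ l⟩
        · have := hdim S hS (by omega)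
          omega)
      (fun F hF hne hdF => by
        obtain ⟨S, hS, hcard, rfl⟩ := exists_eq_image_tightFace hdn h₁ hcube hF hne (by
          rintro rfl
          have := hpoly.2.2
          omega)
        have := hdim S hS hcard
        exact ⟨S, hS, by omega, rfl⟩)
      (fun S T hS hSc hT hTc => by
        rw [← ((hcube S).2 hS).tightFace_subset_iff]
        refine ⟨fun hsub x hx => ?_, fun hsub => Set.image_mono hsub⟩
        obtain ⟨l, hl⟩ := exists_functional_of_rowsSpanPositively hdn h₂ hcube hT hTc
        obtain ⟨x', hx', heq⟩ := hsub ⟨x, hx, rfl⟩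
        rw [hl] at hx' ⊢
        refine ⟨tightFace_anti _ (Set.empty_subset S) hx, ?_⟩
        rw [← heq]
        exact hx'.2)
    exact ⟨e'.symm.trans e⟩

theorem mainTheorem1 (n d : ℕ) (hd : 2 ≤ d) (hdn : d ≤ n) :
    (∃ P : Set (Fin d → ℝ), IsNeighborlyCubical n d P) ∧
    (∃ v : Fin (n - 1) → Fin (d - 2) → ℝ, IsNeighborlyGeneral v) ∧
    ∀ v : Fin (n - 1) → Fin (d - 2) → ℝ, IsNeighborlyGeneral v →
      (∃ g : Matrix (Fin (d - 1)) (Fin (n - d)) ℝ, IsGaleTransform v (stackIdentity g)) ∧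
      ∀ g : Matrix (Fin (d - 1)) (Fin (n - d)) ℝ, IsGaleTransform v (stackIdentity g) →
        ∃ ε₀ : ℝ, 0 < ε₀ ∧ ∀ ε : ℝ, 0 < ε → ε < ε₀ →
          (∃ b : Fin n × Bool → ℝ, IsSuitableRhs ε g b) ∧
          ∀ b : Fin n × Bool → ℝ, IsSuitableRhs ε g b →
            IsPolytopeOfDim n (deformedCube ε g b) ∧
            CombEquiv (deformedCube ε g b) (stdCube n) ∧
            IsNeighborlyCubical n d (lastCoords hdn '' deformedCube ε g b) := by
  have hv₀ := isNeighborlyGeneral_momentCurve (n - 1) (d - 2)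
  refine ⟨?_, ⟨_, hv₀⟩, fun v hv => ⟨exists_isGaleTransform_stackIdentity hd hdn hv,
    fun g hG => ?_⟩⟩
  · obtain ⟨g, hG⟩ := exists_isGaleTransform_stackIdentity hd hdn hv₀
    obtain ⟨ε₀, hε₀, hε⟩ := exists_forall_rowsSpan hd hdn hv₀ hG
    have hpos : 0 < ε₀ / 2 := half_pos hε₀
    obtain ⟨h₁, h₂⟩ := hε (ε₀ / 2) hpos (half_lt_self hε₀)
    obtain ⟨b, hb⟩ := exists_isSuitableRhs hpos g
    exact ⟨_, isNeighborlyCubical_image_deformedCube hd hdn hpos h₁ h₂ hb⟩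
  · obtain ⟨ε₀, hε₀, hε⟩ := exists_forall_rowsSpan hd hdn hv hG
    refine ⟨ε₀, hε₀, fun ε hpos hlt => ⟨exists_isSuitableRhs hpos g, fun b hb => ?_⟩⟩
    obtain ⟨h₁, h₂⟩ := hε ε hpos hlt
    exact ⟨isPolytopeOfDim_deformedCube hpos hb, combEquiv_deformedCube_stdCube hb,
      isNeighborlyCubical_image_deformedCube hd hdn hpos h₁ h₂ hb⟩
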